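/- Let $v_1,\dots,v_m\in\mathbb{Z}^n$ be primitive vectors (the greatest common divisor of the entries of each $v_j$ is $1$) in general position, i.e. every $n$ of them are linearly independent, and suppose that the zonotope $$Z=\sum_{j=1}^m[0,v_j]=\Big\{\sum_{j=1}^m\alpha_jv_j : 0\le\alpha_j\le1\Big\}\subset\mathbb{R}^n$$ generated by them has non-empty interior. Let $\mathrm{g}_i(Z)$ denote the $i$-th Ehrhart coefficient of $Z$, i.e. the coefficient of $k^i$ in the (unique, existing) polynomial in $k$ of degree at most $n$ with $\#(kZ\cap\mathbb{Z}^n)=\sum_{i}\mathrm{g}_i(Z)k^i$ for all $k\in\mathbb{N}$. Let $DZ=Z-Z$, and for $1\le i\le n$ let $\lambda_i(DZ)=\min\{\lambda>0:\dim(\lambda\,DZ\cap\mathbb{Z}^n)\ge i\}$ be the successive minima of $DZ$ (these minima are attained), where $\dim$ denotes the dimension of the affine hull. Let $\sigma_i(Z)$ be the $i$-th elementary symmetric polynomial evaluated at $\frac1{\lambda_1(DZ)},\dots,\frac1{\lambda_n(DZ)}$. Then $$\mathrm{g}_1(Z)=m\le\sum_{i=1}^n\frac1{\lambda_i(DZ)}=\sigma_1(Z).$$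 -/

import Mathlib

open scoped Pointwise

/-- The integer lattice `ℤ^n`, as a subset of `ℝ^n`. -/
def intLattice (n : ℕ) : Set (Fin n → ℝ) :=
  Set.range fun (z : Fin n → ℤ) (i : Fin n) => (z i : ℝ)

/-- The lattice point enumerator `G(K) = #(K ∩ ℤ^n)` (used for bounded sets `K`). -/
noncomputable def latticePointCount {n : ℕ} (K : Set (Fin n → ℝ)) : ℕ :=
  (K ∩ intLattice n).ncard

/-- The dimension of the affine hull of a set. -/
noncomputable def affDim {n : ℕ} (S : Set (Fin n → ℝ)) : ℕ :=
  Module.finrank ℝ (affineSpan ℝ S).direction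

/-- The dilation factors `r > 0` for which `dim (r K ∩ ℤ^n) ≥ i`. -/
def minimaSet {n : ℕ} (K : Set (Fin n → ℝ)) (i : ℕ) : Set ℝ :=
  {r : ℝ | 0 < r ∧ i ≤ affDim ((r • K) ∩ intLattice n)}

/-- Minkowski's `i`-th successive minimum of `K` with respect to `ℤ^n`, `1 ≤ i ≤ n`. -/
noncomputable def successiveMinimum {n : ℕ} (K : Set (Fin n → ℝ)) (i : ℕ) : ℝ :=
  sInf (minimaSet K i)

/-- `σ_i(P)`: the `i`-th elementary symmetric polynomial evaluated at
`1 / λ_1(DP), …, 1 / λ_n(DP)`, where `DP = P - P`. -/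
noncomputable def sigmaMinima {n : ℕ} (i : ℕ) (P : Set (Fin n → ℝ)) : ℝ :=
  MvPolynomial.eval (fun j : Fin n => 1 / successiveMinimum (P - P) (j.val + 1))
    (MvPolynomial.esymm (Fin n) ℝ i)

/-- `p` is an Ehrhart polynomial of `P`: it has degree at most `n` and
`G(kP) = p(k)` for every `k ∈ ℕ`. -/
def IsEhrhartPolynomial {n : ℕ} (P : Set (Fin n → ℝ)) (p : Polynomial ℝ) : Prop :=
  p.natDegree ≤ n ∧ ∀ k : ℕ, (latticePointCount ((k : ℝ) • P) : ℝ) = p.eval (k : ℝ)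

theorem IsEhrhartPolynomial.unique {n : ℕ} {P : Set (Fin n → ℝ)} {p q : Polynomial ℝ}
    (hp : IsEhrhartPolynomial P p) (hq : IsEhrhartPolynomial P q) : p = q := by
  refine Polynomial.eq_of_infinite_eval_eq p q ?_
  refine (Set.infinite_range_of_injective (Nat.cast_injective (R := ℝ))).mono ?_
  rintro _ ⟨k, rfl⟩
  exact (hp.2 k).symm.trans (hq.2 k)

/-- The Ehrhart polynomial of `P` (unique when it exists, arbitrary otherwise). -/
noncomputable def ehrhartPolynomial {n : ℕ} (P : Set (Fin n → ℝ)) : Polynomial ℝ :=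
  Classical.epsilon (IsEhrhartPolynomial P)

/-- The `i`-th Ehrhart coefficient `g_i(P)`. -/
noncomputable def ehrhartCoeff {n : ℕ} (i : ℕ) (P : Set (Fin n → ℝ)) : ℝ :=
  (ehrhartPolynomial P).coeff i

theorem IsEhrhartPolynomial.ehrhartCoeff_eq {n : ℕ} {P : Set (Fin n → ℝ)} {p : Polynomial ℝ}
    (hp : IsEhrhartPolynomial P p) (i : ℕ) : ehrhartCoeff i P = p.coeff i := by
  have h : IsEhrhartPolynomial P (ehrhartPolynomial P) := Classical.epsilon_spec ⟨p, hp⟩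
  rw [ehrhartCoeff, h.unique hp]

/-- An integer vector regarded as a real vector. -/
def toRealVec {n : ℕ} (z : Fin n → ℤ) : Fin n → ℝ := fun i => (z i : ℝ)

/-- The zonotope `∑ j, [0, v_j]` generated by the integer vectors `v_1, …, v_m`. -/
def latticeZonotope {n m : ℕ} (v : Fin m → Fin n → ℤ) : Set (Fin n → ℝ) :=
  {x | ∃ a : Fin m → ℝ, (∀ j, 0 ≤ a j ∧ a j ≤ 1) ∧ x = ∑ j, a j • toRealVec (v j)}

/-- An integer vector is primitive if the gcd of its entries is one. (In particular it is
nonzero, as the gcd of the zero vector is zero.) -/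
def IsPrimitiveVec {n : ℕ} (z : Fin n → ℤ) : Prop :=
  Finset.univ.gcd z = 1

/-- Every `n` of the vectors `v_1, …, v_m` in `ℤ^n` are linearly independent. -/
def InGeneralPosition {n m : ℕ} (v : Fin m → Fin n → ℤ) : Prop :=
  ∀ J : Finset (Fin m), J.card = n → LinearIndependent ℝ fun j : J => toRealVec (v j)

/-! The inequality is AM-GM applied to $1/\lambda_i(DZ)$, once $\prod_i 1/\lambda_i(DZ) \ge (m/n)^n$
is known. Minkowski's second theorem gives $\prod_i \lambda_i(DZ)\cdot\mathrm{vol}(DZ) \le 2^n$.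
Since $Z$ is centrally symmetric, $\mathrm{vol}(DZ) = 2^n\,\mathrm{vol}(Z)$, so $\prod_i
1/\lambda_i(DZ) \ge \mathrm{vol}(Z)$. Each $n$ of the generators are independent integer vectors and
contribute at least $1$ to the volume, so $\mathrm{vol}(Z) \ge \binom mn \ge (m/n)^n$.

The Ehrhart data come from deletion-contraction (`ncard_zonotopePoints_insert`): adding a generator
$w$ adds $k$ points on every line in direction $w$ that meets the old zonotope, and these lines are
the points of the zonotope projected to $M/\mathbb{Z}w$. So $p = p_{\mathrm{del}} +
X\,p_{\mathrm{con}}$. The contraction may have torsion, hence the work with arbitrary finitely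
generated abelian groups. The linear coefficient sums the torsion orders of $M/\mathbb{Z}v_j$, all
$1$ for primitive vectors; the top coefficient obeys Pascal's rule.

Minkowski's theorem is proved by measuring dilates of an open body modulo subgroups of
$\mathbb{Z}^n$ (`cosetMeasure`): the measure modulo $\mathbb{Z}^n$ is at most $1$, and it grows by a
controlled power between consecutive minima (`cosetMeasure_smul_ge`). -/

/-! ### Measure of a set modulo a countable subgroup -/

section CosetMeasure

open MeasureTheory
open scoped ENNReal

variable {E : Type*} [AddCommGroup E]

/-- The number of points of the coset `x + Γ` that lie in `A`. -/
noncomputable def cosetCount (Γ : AddSubgroup E) (A : Set E) (x : E) : ℝ≥0∞ :=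
  ∑' γ : Γ, A.indicator 1 (x + γ)

/-- The measure of the image of `A` in `E ⧸ Γ`, computed upstairs: every point of `A` is weighted
by the inverse of the number of points of `A` in its coset. -/
noncomputable def cosetMeasure [MeasurableSpace E] (μ : Measure E) (Γ : AddSubgroup E)
    (A : Set E) : ℝ≥0∞ :=
  ∫⁻ x in A, (cosetCount Γ A x)⁻¹ ∂μ

theorem cosetCount_add_mem (Γ : AddSubgroup E) (A : Set E) (x : E) (γ : Γ) :
    cosetCount Γ A (x + γ) = cosetCount Γ A x := by
  unfold cosetCount
  rw [← (Equiv.addLeft γ).tsum_eq fun γ' : Γ => A.indicator (1 : E → ℝ≥0∞) (x + γ')]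
  simp [add_assoc]

theorem cosetCount_ne_zero {Γ : AddSubgroup E} {A : Set E} {x : E} (hx : x ∈ A) :
    cosetCount Γ A x ≠ 0 := by
  intro h
  have := ENNReal.tsum_eq_zero.1 h 0
  simp [hx] at this

theorem cosetCount_ne_top {Γ : AddSubgroup E} {A : Set E} {x : E}
    (h : {γ : Γ | x + (γ : E) ∈ A}.Finite) : cosetCount Γ A x ≠ ⊤ := by
  unfold cosetCount
  rw [tsum_eq_sum (s := h.toFinset)]
  · refine ENNReal.sum_ne_top.2 fun γ _ => ?_
    by_cases hγ : x + (γ : E) ∈ A <;> simp [hγ]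
  · intro γ hγ
    have : x + (γ : E) ∉ A := by simpa using hγ
    simp [this]

theorem cosetCount_le {Γ Γ' : AddSubgroup E} {A : Set E} (h : Γ ≤ Γ') (x : E) :
    cosetCount Γ A x ≤ cosetCount Γ' A x :=
  ENNReal.tsum_comp_le_tsum_of_injective (AddSubgroup.inclusion_injective h)
    fun γ : Γ' => A.indicator (1 : E → ℝ≥0∞) (x + γ)

/-- A translate $x+\gamma$ with $\gamma \in \Gamma' \setminus \Gamma$ cannot lie in $A$, so the
extra terms of the larger sum vanish. -/
theorem cosetCount_eq_of_sub_mem {Γ Γ' : AddSubgroup E} {A : Set E} (h : Γ ≤ Γ')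
    (hA : ∀ x ∈ A, ∀ y ∈ A, y - x ∈ Γ' → y - x ∈ Γ) {x : E} (hx : x ∈ A) :
    cosetCount Γ A x = cosetCount Γ' A x := by
  unfold cosetCount
  rw [← (AddSubgroup.inclusion_injective h).tsum_eq
    (f := fun γ : Γ' => A.indicator (1 : E → ℝ≥0∞) (x + γ))]
  · rfl
  · intro γ hγ
    have hxγ : x + (γ : E) ∈ A := by
      by_contra hn
      simp [hn] at hγ
    have := hA x hx _ hxγ (by simp)
    exact ⟨⟨γ, by simpa using this⟩, rfl⟩

theorem cosetCount_preimage_add (Γ : AddSubgroup E) (A : Set E) (a x : E) :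
    cosetCount Γ ((· + a) ⁻¹' A) x = cosetCount Γ A (x + a) := by
  unfold cosetCount
  congr 1 with γ
  simp only [Set.indicator, Set.mem_preimage]
  rw [add_right_comm]
  rfl

theorem cosetMeasure_eq_lintegral [MeasurableSpace E] (μ : Measure E) (Γ : AddSubgroup E) {A : Set E}
    (hA : MeasurableSet A) :
    cosetMeasure μ Γ A = ∫⁻ x, A.indicator 1 x * (cosetCount Γ A x)⁻¹ ∂μ := by
  rw [cosetMeasure, ← lintegral_indicator hA]
  congr 1 with x
  by_cases hx : x ∈ A <;> simp [hx]

variable [MeasurableSpace E] [MeasurableAdd E]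

theorem measurable_cosetCount (Γ : AddSubgroup E) [Countable Γ] {A : Set E}
    (hA : MeasurableSet A) : Measurable (cosetCount Γ A) := by
  refine Measurable.tsum fun γ => ?_
  exact (measurable_one.indicator hA).comp (measurable_add_const (γ : E))

/-- Mass transport: a set that meets at least the cosets met by `A` has at least its
measure in the quotient. -/
theorem cosetMeasure_le_cosetMeasure (μ : Measure E) [μ.IsAddRightInvariant]
    (Γ : AddSubgroup E) [Countable Γ] {A B : Set E} (hA : MeasurableSet A) (hB : MeasurableSet B)
    (h0 : ∀ x ∈ A, cosetCount Γ B x ≠ 0) (ht : ∀ x ∈ A, cosetCount Γ B x ≠ ⊤) :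
    cosetMeasure μ Γ A ≤ cosetMeasure μ Γ B := by
  have mA := measurable_cosetCount Γ hA
  have mB := measurable_cosetCount Γ hB
  have iA : Measurable (A.indicator (1 : E → ℝ≥0∞)) := measurable_one.indicator hA
  have iB : Measurable (B.indicator (1 : E → ℝ≥0∞)) := measurable_one.indicator hB
  rw [cosetMeasure_eq_lintegral μ Γ hA, cosetMeasure_eq_lintegral μ Γ hB]
  -- A $\Gamma$-periodic weight on pairs $(x, x+\gamma) \in A \times B$: summing over the $B$-end
  -- recovers the integrand for $A$, and summing over the $A$-end gives at most the one for $B$.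
  set w : E → ℝ≥0∞ := fun x => (cosetCount Γ A x)⁻¹ * (cosetCount Γ B x)⁻¹ with hw
  have mw : Measurable w := mA.inv.mul mB.inv
  have wper : ∀ (x : E) (γ : Γ), w (x + γ) = w x := fun x γ => by
    simp only [hw, cosetCount_add_mem]
  calc ∫⁻ x, A.indicator 1 x * (cosetCount Γ A x)⁻¹ ∂μ
      = ∫⁻ x, ∑' γ : Γ, A.indicator 1 x * w x * B.indicator 1 (x + γ) ∂μ := by
        congr 1 with x
        rw [ENNReal.tsum_mul_left]
        change _ = _ * cosetCount Γ B x
        by_cases hx : x ∈ A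
        · simp only [hw]
          rw [mul_assoc, mul_assoc, ENNReal.inv_mul_cancel (h0 x hx) (ht x hx), mul_one]
        · simp [hx]
    _ = ∑' γ : Γ, ∫⁻ x, A.indicator 1 x * w x * B.indicator 1 (x + γ) ∂μ := by
        refine lintegral_tsum fun γ => Measurable.aemeasurable ?_
        exact (iA.mul mw).mul (iB.comp (measurable_add_const (γ : E)))
    _ = ∑' γ : Γ, ∫⁻ y, A.indicator 1 (y + ((-γ : Γ) : E)) * w y * B.indicator 1 y ∂μ := by
        congr 1 with γ
        rw [← lintegral_add_right_eq_self
          (fun y => A.indicator 1 (y + ((-γ : Γ) : E)) * w y * B.indicator 1 y) (γ : E)]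
        congr 1 with y
        simp [wper]
    _ = ∫⁻ y, ∑' γ : Γ, A.indicator 1 (y + ((-γ : Γ) : E)) * w y * B.indicator 1 y ∂μ := by
        refine (lintegral_tsum fun γ => Measurable.aemeasurable ?_).symm
        exact ((iA.comp (measurable_add_const _)).mul mw).mul iB
    _ ≤ ∫⁻ y, B.indicator 1 y * (cosetCount Γ B y)⁻¹ ∂μ := by
        refine lintegral_mono fun y => ?_
        simp only
        rw [ENNReal.tsum_mul_right, ENNReal.tsum_mul_right]
        have := (Equiv.neg Γ).tsum_eq (fun γ : Γ => A.indicator (1 : E → ℝ≥0∞) (y + γ))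
        simp only [Equiv.neg_apply] at this
        rw [this]
        change cosetCount Γ A y * w y * _ ≤ _
        rw [mul_comm, hw]
        simp only [← mul_assoc]
        gcongr
        rw [mul_assoc]
        -- $c\,c^{-1} \le 1$ holds also for $c = 0$ and $c = \infty$, so the counts of $A$ need no
        -- hypothesis.
        exact mul_le_of_le_one_right' (ENNReal.mul_inv_le_one _)

theorem cosetMeasure_preimage_add (μ : Measure E) [μ.IsAddRightInvariant]
    (Γ : AddSubgroup E) {A : Set E} (hA : MeasurableSet A) (a : E) :
    cosetMeasure μ Γ ((· + a) ⁻¹' A) = cosetMeasure μ Γ A := by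
  rw [cosetMeasure_eq_lintegral μ Γ hA,
    cosetMeasure_eq_lintegral μ Γ ((measurable_add_const a) hA),
    ← lintegral_add_right_eq_self (fun x => A.indicator 1 x * (cosetCount Γ A x)⁻¹) a]
  simp only [cosetCount_preimage_add]
  rfl

end CosetMeasure

/-! ### Growth of the quotient measure under dilation -/

section CosetMeasureScaling

open MeasureTheory
open scoped ENNReal

theorem cosetMeasure_mono_set {E : Type*} [AddCommGroup E] [MeasurableSpace E] [MeasurableAdd E]
    (μ : Measure E) [μ.IsAddRightInvariant]
    (Γ : AddSubgroup E) [Countable Γ] {A B : Set E} (hA : MeasurableSet A) (hB : MeasurableSet B)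
    (h : A ⊆ B) (ht : ∀ x ∈ A, cosetCount Γ B x ≠ ⊤) :
    cosetMeasure μ Γ A ≤ cosetMeasure μ Γ B :=
  cosetMeasure_le_cosetMeasure μ Γ hA hB (fun _ hx => cosetCount_ne_zero (h hx)) ht

section Prod

variable {X Y : Type*} [AddCommGroup X] [AddCommGroup Y]

theorem cosetCount_prod_bot (Γ : AddSubgroup X) (A : Set (X × Y)) (x : X) (y : Y) :
    cosetCount (Γ.prod (⊥ : AddSubgroup Y)) A (x, y) = cosetCount Γ ((·, y) ⁻¹' A) x := by
  unfold cosetCount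
  let e : Γ ≃ Γ.prod (⊥ : AddSubgroup Y) :=
    { toFun := fun γ => ⟨(γ, 0), by simp [AddSubgroup.mem_prod]⟩
      invFun := fun γ => ⟨γ.1.1, (AddSubgroup.mem_prod.1 γ.2).1⟩
      left_inv := fun γ => rfl
      right_inv := fun γ => by
        ext
        · rfl
        · exact ((AddSubgroup.mem_bot.1 (AddSubgroup.mem_prod.1 γ.2).2)).symm }
  rw [← e.tsum_eq]
  congr 1 with γ
  simp only [e, Equiv.coe_fn_mk, Prod.mk_add_mk, add_zero]
  rfl

instance countable_prod_bot (Γ : AddSubgroup X) [Countable Γ] :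
    Countable (Γ.prod (⊥ : AddSubgroup Y)) :=
  (AddSubgroup.prodEquiv Γ (⊥ : AddSubgroup Y)).toEquiv.countable_iff.2 inferInstance

/-- Tonelli: translations by $\Gamma \times 0$ fix $y$, so the coset count is computed inside each
section. -/
theorem cosetMeasure_prod_bot [MeasurableSpace X] [MeasurableSpace Y] [MeasurableAdd X]
    [MeasurableAdd (X × Y)] (μ : Measure X) (ν : Measure Y) [SFinite μ] [SFinite ν]
    (Γ : AddSubgroup X) [Countable Γ] {A : Set (X × Y)} (hA : MeasurableSet A) :
    cosetMeasure (μ.prod ν) (Γ.prod ⊥) A = ∫⁻ y, cosetMeasure μ Γ ((·, y) ⁻¹' A) ∂ν := by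
  rw [cosetMeasure_eq_lintegral _ _ hA, lintegral_prod_symm]
  · congr 1 with y
    rw [cosetMeasure_eq_lintegral _ _ (measurable_prodMk_right hA)]
    congr 1 with x
    rw [cosetCount_prod_bot]
    rfl
  · exact ((measurable_one.indicator hA).mul (measurable_cosetCount _ hA).inv).aemeasurable

theorem measurable_cosetMeasure_section [MeasurableSpace X] [MeasurableSpace Y] [MeasurableAdd X]
    [MeasurableAdd (X × Y)] (μ : Measure X) [SFinite μ]
    (Γ : AddSubgroup X) [Countable Γ] {A : Set (X × Y)} (hA : MeasurableSet A) :
    Measurable fun y => cosetMeasure μ Γ ((·, y) ⁻¹' A) := by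
  have : Measurable fun p : X × Y =>
      A.indicator 1 p * (cosetCount (Γ.prod (⊥ : AddSubgroup Y)) A p)⁻¹ :=
    (measurable_one.indicator hA).mul (measurable_cosetCount _ hA).inv
  convert! this.lintegral_prod_left' (μ := μ) using 2 with y
  rw [cosetMeasure_eq_lintegral _ _ (measurable_prodMk_right hA)]
  congr 1 with x
  rw [cosetCount_prod_bot]
  rfl

end Prod

theorem lintegral_eq_pow_mul_lintegral_comp_smul {Y : Type*} [NormedAddCommGroup Y]
    [NormedSpace ℝ Y] [MeasurableSpace Y] [BorelSpace Y] [FiniteDimensional ℝ Y]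
    (ν : Measure Y) [ν.IsAddHaarMeasure] {f : Y → ℝ≥0∞} (hf : Measurable f) {r : ℝ} (hr : 0 < r) :
    ∫⁻ y, f y ∂ν = ENNReal.ofReal (r ^ Module.finrank ℝ Y) * ∫⁻ y, f (r • y) ∂ν := by
  have h := lintegral_map (μ := ν) hf (measurable_const_smul r)
  rw [Measure.map_addHaar_smul ν hr.ne', lintegral_smul_measure] at h
  rw [← h, smul_eq_mul, ← mul_assoc, ← ENNReal.ofReal_mul (by positivity),
    abs_of_pos (by positivity), mul_inv_cancel₀ (by positivity)]
  simp

/-- Substituting $ry$ for $y$ produces the factor $r^{\dim Y}$. It remains to see that the section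
of $rA$ over $ry$ is at least as large as that of $A$ over $y$. By convexity it contains a translate
of the latter. -/
theorem cosetMeasure_prod_smul_ge {X Y : Type*} [NormedAddCommGroup X] [NormedSpace ℝ X]
    [MeasurableSpace X] [BorelSpace X] [NormedAddCommGroup Y]
    [NormedSpace ℝ Y] [MeasurableSpace Y] [BorelSpace Y] [FiniteDimensional ℝ Y]
    [SecondCountableTopology X]
    (μ : Measure X) [SFinite μ] [μ.IsAddRightInvariant] (ν : Measure Y) [ν.IsAddHaarMeasure]
    (Γ : AddSubgroup X) [Countable Γ] {A : Set (X × Y)} (hA : MeasurableSet A)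
    (hconv : Convex ℝ A) {r : ℝ} (hr : 1 ≤ r)
    (hfin : ∀ p, cosetCount (Γ.prod ⊥) (r • A) p ≠ ⊤) :
    ENNReal.ofReal (r ^ Module.finrank ℝ Y) * cosetMeasure (μ.prod ν) (Γ.prod ⊥) A ≤
      cosetMeasure (μ.prod ν) (Γ.prod ⊥) (r • A) := by
  have hr0 : 0 < r := by linarith
  have hrA : MeasurableSet (r • A) := hA.const_smul₀ r
  rw [cosetMeasure_prod_bot μ ν Γ hA, cosetMeasure_prod_bot μ ν Γ hrA,
    lintegral_eq_pow_mul_lintegral_comp_smul ν (measurable_cosetMeasure_section μ Γ hrA) hr0]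
  gcongr with y
  rcases ((·, y) ⁻¹' A).eq_empty_or_nonempty with h | ⟨a, ha⟩
  · simp [h, cosetMeasure]
  · have mA : MeasurableSet ((·, y) ⁻¹' A) := measurable_prodMk_right hA
    -- For $x'$ and $a$ in the section of $A$, $x' + (r-1)a = r\,(r^{-1}x' + (1-r^{-1})a)$, and the
    -- bracket lies in the section by convexity.
    rw [← cosetMeasure_preimage_add μ Γ mA (-((r - 1) • a))]
    refine cosetMeasure_mono_set μ Γ (measurable_add_const _ mA) (measurable_prodMk_right hrA)
      (fun x hx => ?_) fun x _ => ?_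
    · have h := hconv hx ha (a := r⁻¹) (b := 1 - r⁻¹) (by positivity)
        (by rw [sub_nonneg]; exact inv_le_one_of_one_le₀ hr) (by ring)
      refine Set.mem_smul_set.2 ⟨_, h, ?_⟩
      ext
      · have : r * (1 - r⁻¹) = r - 1 := by field_simp
        simp only [Prod.smul_mk, Prod.mk_add_mk, smul_add, smul_smul,
          mul_inv_cancel₀ hr0.ne', one_smul, this]
        abel
      · simp only [Prod.smul_mk, Prod.mk_add_mk, smul_add, smul_smul, ← add_smul]
        congr 1
        field_simp
        ring
    · rw [← cosetCount_prod_bot]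
      exact hfin _

theorem cosetMeasure_smul_measure {E : Type*} [AddCommGroup E] [MeasurableSpace E] (c : ℝ≥0∞)
    (μ : Measure E) (Γ : AddSubgroup E) (A : Set E) :
    cosetMeasure (c • μ) Γ A = c * cosetMeasure μ Γ A := by
  simp [cosetMeasure]

theorem cosetCount_map {E F : Type*} [AddCommGroup E] [AddCommGroup F] (e : F ≃+ E)
    (Γ : AddSubgroup E) (A : Set E) (x : F) :
    cosetCount Γ A (e x) = cosetCount (Γ.comap (e : F →+ E)) (e ⁻¹' A) x := by
  unfold cosetCount
  let f : Γ.comap (e : F →+ E) ≃ Γ :=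
    { toFun := fun γ => ⟨e γ, γ.2⟩
      invFun := fun γ => ⟨e.symm γ, by simp [AddSubgroup.mem_comap]⟩
      left_inv := fun γ => by simp
      right_inv := fun γ => by simp }
  rw [← f.tsum_eq]
  congr 1 with γ
  simp only [f, Equiv.coe_fn_mk, ← map_add]
  rfl

theorem cosetMeasure_map {E F : Type*} [AddCommGroup E] [AddCommGroup F] [MeasurableSpace E]
    [MeasurableSpace F] [MeasurableAdd E] (e : F ≃+ E) (he : Measurable e) (μ : Measure F)
    (Γ : AddSubgroup E) [Countable Γ] {A : Set E} (hA : MeasurableSet A) :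
    cosetMeasure (μ.map e) Γ A = cosetMeasure μ (Γ.comap (e : F →+ E)) (e ⁻¹' A) := by
  rw [cosetMeasure_eq_lintegral _ _ hA, cosetMeasure_eq_lintegral _ _ (he hA),
    lintegral_map _ he]
  · simp only [cosetCount_map]
    rfl
  · exact (measurable_one.indicator hA).mul (measurable_cosetCount Γ hA).inv

/-- Scaling by `r ≥ 1` a convex set multiplies its measure modulo `Γ` by at least
`r ^ codim V`, for any subspace `V` containing `Γ`. -/
theorem cosetMeasure_smul_ge {E : Type*} [NormedAddCommGroup E] [NormedSpace ℝ E]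
    [MeasurableSpace E] [BorelSpace E] [FiniteDimensional ℝ E] (μ : Measure E)
    [μ.IsAddHaarMeasure] (Γ : AddSubgroup E) [Countable Γ] (V : Submodule ℝ E)
    (hΓ : ∀ γ ∈ Γ, γ ∈ V) {A : Set E} (hA : MeasurableSet A)
    (hconv : Convex ℝ A) {r : ℝ} (hr : 1 ≤ r)
    (hfin : ∀ p, cosetCount Γ (r • A) p ≠ ⊤) :
    ENNReal.ofReal (r ^ (Module.finrank ℝ E - Module.finrank ℝ V)) * cosetMeasure μ Γ A ≤
      cosetMeasure μ Γ (r • A) := by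
  obtain ⟨W, hVW⟩ := V.exists_isCompl
  have : Module.finrank ℝ E - Module.finrank ℝ V = Module.finrank ℝ W := by
    rw [← Submodule.finrank_add_eq_of_isCompl hVW]
    omega
  rw [this]
  let e : (V × W) ≃L[ℝ] E := (Submodule.prodEquivOfIsCompl V W hVW).toContinuousLinearEquiv
  have he : ∀ p, e p = p.1 + p.2 := fun p => by simp [e]
  have me : Measurable e := e.continuous.measurable
  let μV : Measure V := Measure.addHaar
  let μW : Measure W := Measure.addHaar
  obtain ⟨c, hc⟩ : ∃ c : ℝ≥0∞, μ = c • (μV.prod μW).map e := by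
    exact ⟨_, Measure.isAddLeftInvariant_eq_smul μ ((μV.prod μW).map e)⟩
  let e' : (V × W) ≃+ E := e.toLinearEquiv.toAddEquiv
  have hr0 : r ≠ 0 := by linarith
  -- As $\Gamma \subseteq V$, its elements have no $W$-component, which is the product situation
  -- treated above.
  have hΓ' : Γ.comap (e' : (V × W) →+ E) = (Γ.comap (V.subtype : V →+ E)).prod ⊥ := by
    ext ⟨x, y⟩
    have hxy : e' (x, y) = x + y := he (x, y)
    simp only [AddSubgroup.mem_comap, AddSubgroup.mem_prod, AddSubgroup.mem_bot]
    change e' (x, y) ∈ Γ ↔ (x : E) ∈ Γ ∧ _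
    rw [hxy]
    refine ⟨fun h => ?_, fun h => by simpa [h.2] using h.1⟩
    have hyV : (y : E) ∈ V := (V.add_mem_iff_right x.2).1 (hΓ _ h)
    have hy : (y : E) = 0 := Submodule.disjoint_def.1 hVW.disjoint _ hyV y.2
    exact ⟨by simpa [hy] using h, by ext; exact hy⟩
  have key : ∀ B : Set E, MeasurableSet B → cosetMeasure μ Γ B =
      c * cosetMeasure (μV.prod μW) ((Γ.comap (V.subtype : V →+ E)).prod ⊥) (e ⁻¹' B) := by
    intro B hB
    rw [hc, cosetMeasure_smul_measure, ← hΓ']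
    congr 1
    exact cosetMeasure_map e' me _ Γ hB
  have hsmul : e ⁻¹' (r • A) = r • (e ⁻¹' A) := by
    ext p
    rw [Set.mem_preimage, Set.mem_smul_set_iff_inv_smul_mem₀ hr0,
      Set.mem_smul_set_iff_inv_smul_mem₀ hr0, Set.mem_preimage, map_smul]
  have : Countable (Γ.comap (V.subtype : V →+ E)) :=
    Function.Injective.countable (f := fun γ => (⟨(γ : V), γ.2⟩ : Γ)) fun a b h =>
      Subtype.ext (Subtype.ext (Subtype.mk.inj h))
  rw [key A hA, key _ (hA.const_smul₀ r), hsmul, ← mul_assoc, mul_comm _ c, mul_assoc]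
  gcongr
  refine cosetMeasure_prod_smul_ge μV μW _ (me hA)
    (hconv.linear_preimage e.toLinearEquiv.toLinearMap) hr fun p => ?_
  rw [← hsmul, ← hΓ']
  exact (cosetCount_map e' Γ (r • A) p).symm ▸ hfin (e p)

end CosetMeasureScaling

/-! ### Minkowski's second theorem for open symmetric convex sets -/

section MinkowskiSecond

open MeasureTheory
open scoped ENNReal

theorem span_basisFun_eq_intLattice (n : ℕ) :
    (Submodule.span ℤ (Set.range (Pi.basisFun ℝ (Fin n))) : Set (Fin n → ℝ)) = intLattice n := by
  ext x
  rw [SetLike.mem_coe, Module.Basis.mem_span_iff_repr_mem]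
  constructor
  · intro h
    choose z hz using h
    exact ⟨z, funext fun i => by simpa using hz i⟩
  · rintro ⟨z, rfl⟩ i
    exact ⟨z i, by simp⟩

theorem finite_inter_intLattice {n : ℕ} {K : Set (Fin n → ℝ)} (hK : Bornology.IsBounded K) :
    (K ∩ intLattice n).Finite := by
  rw [← span_basisFun_eq_intLattice]
  exact ZSpan.setFinite_inter _ hK

/-- The integer lattice as an additive subgroup. -/
def intLatticeSubgroup (n : ℕ) : AddSubgroup (Fin n → ℝ) where
  carrier := intLattice n
  zero_mem' := ⟨0, by ext; simp⟩
  add_mem' := by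
    rintro _ _ ⟨x, rfl⟩ ⟨y, rfl⟩
    exact ⟨x + y, by ext; simp⟩
  neg_mem' := by
    rintro _ ⟨x, rfl⟩
    exact ⟨-x, by ext; simp⟩

theorem countable_of_le_intLatticeSubgroup {n : ℕ} {Γ : AddSubgroup (Fin n → ℝ)}
    (h : Γ ≤ intLatticeSubgroup n) : Countable Γ :=
  ((Set.countable_range _).mono fun _ hx => h hx : (Γ : Set (Fin n → ℝ)).Countable).to_subtype

theorem cosetCount_ne_top_of_isBounded {n : ℕ} {Γ : AddSubgroup (Fin n → ℝ)}
    (h : Γ ≤ intLatticeSubgroup n) {A : Set (Fin n → ℝ)} (hA : Bornology.IsBounded A)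
    (x : Fin n → ℝ) : cosetCount Γ A x ≠ ⊤ := by
  have hb : Bornology.IsBounded ((fun y => -x + y) '' A) := by
    simpa [Set.singleton_add] using (Bornology.isBounded_singleton (x := -x)).add hA
  refine cosetCount_ne_top (Set.Finite.of_finite_image (f := fun γ : Γ => (γ : Fin n → ℝ))
    ((finite_inter_intLattice hb).subset ?_) Subtype.val_injective.injOn)
  rintro _ ⟨γ, hγ, rfl⟩
  exact ⟨⟨_, hγ, by simp⟩, h γ.2⟩

theorem one_le_cosetCount {E : Type*} [AddCommGroup E] {Γ : AddSubgroup E} {A : Set E} {x : E}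
    (hx : x ∈ A) : 1 ≤ cosetCount Γ A x := by
  have := ENNReal.le_tsum (f := fun γ : Γ => A.indicator (1 : E → ℝ≥0∞) (x + γ)) 0
  simpa [hx, cosetCount] using this

theorem cosetMeasure_le_measure {E : Type*} [AddCommGroup E] [MeasurableSpace E] (μ : Measure E)
    (Γ : AddSubgroup E) {A : Set E} (hA : MeasurableSet A) : cosetMeasure μ Γ A ≤ μ A := by
  rw [← setLIntegral_one]
  exact setLIntegral_mono' hA fun x hx => ENNReal.inv_le_one.2 (one_le_cosetCount hx)

theorem cosetMeasure_bot {E : Type*} [AddCommGroup E] [MeasurableSpace E] (μ : Measure E)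
    {A : Set E} (hA : MeasurableSet A) : cosetMeasure μ ⊥ A = μ A := by
  rw [← setLIntegral_one]
  refine setLIntegral_congr_fun hA fun x hx => ?_
  have : cosetCount ⊥ A x = 1 := by
    unfold cosetCount
    rw [tsum_eq_single 0 fun b hb => absurd (Subsingleton.elim b 0) hb]
    simp [hx]
  simp [this]

theorem cosetMeasure_le_of_le {E : Type*} [AddCommGroup E] [MeasurableSpace E] (μ : Measure E)
    {Γ Γ' : AddSubgroup E} (h : Γ ≤ Γ') (A : Set E) :
    cosetMeasure μ Γ' A ≤ cosetMeasure μ Γ A :=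
  lintegral_mono fun x => ENNReal.inv_le_inv.2 (cosetCount_le h x)

theorem cosetMeasure_eq_of_sub_mem {E : Type*} [AddCommGroup E] [MeasurableSpace E]
    (μ : Measure E) {Γ Γ' : AddSubgroup E} {A : Set E} (hA : MeasurableSet A) (h : Γ ≤ Γ')
    (hsub : ∀ x ∈ A, ∀ y ∈ A, y - x ∈ Γ' → y - x ∈ Γ) :
    cosetMeasure μ Γ' A = cosetMeasure μ Γ A :=
  setLIntegral_congr_fun hA fun x hx => by
    simp only [cosetCount_eq_of_sub_mem h hsub hx]

/-- The half-open unit cube meets every coset of $\mathbb{Z}^n$ and has volume $1$; mass transport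
compares $A$ with it. -/
theorem cosetMeasure_intLattice_le_one {n : ℕ} {A : Set (Fin n → ℝ)} (hA : MeasurableSet A) :
    cosetMeasure volume (intLatticeSubgroup n) A ≤ 1 := by
  have := countable_of_le_intLatticeSubgroup (le_refl (intLatticeSubgroup n))
  set B : Set (Fin n → ℝ) := Set.pi Set.univ fun _ => Set.Ico 0 1 with hB
  have mB : MeasurableSet B := MeasurableSet.univ_pi fun _ => measurableSet_Ico
  have bB : Bornology.IsBounded B := Bornology.IsBounded.pi fun _ => Metric.isBounded_Ico 0 1
  calc cosetMeasure volume (intLatticeSubgroup n) A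
      ≤ cosetMeasure volume (intLatticeSubgroup n) B := by
        refine cosetMeasure_le_cosetMeasure _ _ hA mB (fun x _ => ?_)
          fun x _ => cosetCount_ne_top_of_isBounded le_rfl bB x
        let γ : intLatticeSubgroup n := ⟨fun i => ((-⌊x i⌋ : ℤ) : ℝ), ⟨fun i => -⌊x i⌋, rfl⟩⟩
        rw [← cosetCount_add_mem _ _ _ γ]
        refine cosetCount_ne_zero fun i _ => ?_
        simp only [Pi.add_apply, γ, Int.cast_neg, ← sub_eq_add_neg]
        exact ⟨Int.fract_nonneg (x i), Int.fract_lt_one (x i)⟩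
    _ ≤ volume B := cosetMeasure_le_measure _ _ mB
    _ = 1 := by simp [hB, volume_pi_pi]

/-- **Minkowski's second theorem** (upper bound), for the integer lattice. The numbers `l i` are
increasing, and the lattice points in `l i • U` span a subspace of dimension at most `i`. -/
theorem minkowski_second {n : ℕ} {U : Set (Fin n → ℝ)} (hopen : IsOpen U) (hconv : Convex ℝ U)
    (hsymm : ∀ x ∈ U, -x ∈ U) (hbdd : Bornology.IsBounded U) {l : ℕ → ℝ}
    (hpos : ∀ i < n, 0 < l i) (hmono : ∀ i, i + 1 < n → l i ≤ l (i + 1))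
    (V : ℕ → Submodule ℝ (Fin n → ℝ)) (hV : ∀ i < n, Module.finrank ℝ (V i) ≤ i)
    (hmem : ∀ i < n, ∀ z ∈ intLattice n, z ∈ l i • U → z ∈ V i) :
    ENNReal.ofReal (∏ i ∈ Finset.range n, l i) * volume U ≤ 2 ^ n := by
  -- Halved, so that by symmetry and convexity a difference of two points of $A_i$ lies in $l_i U$.
  set A : ℕ → Set (Fin n → ℝ) := fun i => (l i / 2) • U with hAdef
  have mU : MeasurableSet U := hopen.measurableSet
  have mA : ∀ i, MeasurableSet (A i) := fun i => mU.const_smul₀ _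
  have cA : ∀ i, Convex ℝ (A i) := fun i => hconv.smul _
  have bA : ∀ i, Bornology.IsBounded (A i) := fun i => hbdd.smul₀ _
  set Γ : ℕ → AddSubgroup (Fin n → ℝ) := fun i =>
    intLatticeSubgroup n ⊓ (V i).toAddSubgroup with hΓ
  have hΓle : ∀ i, Γ i ≤ intLatticeSubgroup n := fun i => inf_le_left
  have hΓc : ∀ i, Countable (Γ i) := fun i => countable_of_le_intLatticeSubgroup (hΓle i)
  -- Lattice differences within $A_i$ lie in $l_i U$, hence in $V_i$: modulo $\mathbb{Z}^n$ or
  -- modulo $\Gamma_i$, the same points of $A_i$ are identified.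
  have heq : ∀ i < n, cosetMeasure volume (intLatticeSubgroup n) (A i) =
      cosetMeasure volume (Γ i) (A i) := by
    intro i hi
    refine cosetMeasure_eq_of_sub_mem _ (mA i) (hΓle i) ?_
    rintro _ ⟨x, hx, rfl⟩ _ ⟨y, hy, rfl⟩ h
    refine ⟨h, hmem i hi _ h ⟨(1 / 2 : ℝ) • y + (1 / 2 : ℝ) • (-x),
      hconv hy (hsymm x hx) (by norm_num) (by norm_num) (by norm_num), ?_⟩⟩
    ext j
    simp
    ring
  -- At $i = n-1$ the left side is the full product of the $l_j$ times $\mathrm{vol}(U)/2^n$, while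
  -- the right side is at most $1$.
  have main : ∀ i < n,
      ENNReal.ofReal ((∏ j ∈ Finset.range i, l j) * l i ^ (n - i) / 2 ^ n) * volume U ≤
        cosetMeasure volume (intLatticeSubgroup n) (A i) := by
    intro i
    induction i with
    | zero =>
      intro hi
      have hV0 : V 0 = ⊥ := Submodule.finrank_eq_zero.1 (Nat.le_zero.1 (hV 0 hi))
      have : Γ 0 = ⊥ := by
        rw [hΓ]
        simp [hV0]
      rw [heq 0 hi, this, cosetMeasure_bot _ (mA 0), Measure.addHaar_smul]
      have := hpos 0 hi
      rw [abs_of_pos (by positivity)]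
      simp [div_pow]
    | succ i ih =>
      intro hi
      have hi' : i < n := by omega
      have p0 := hpos i hi'
      have p1 := hpos _ hi
      have hr : 1 ≤ l (i + 1) / l i := (one_le_div p0).2 (hmono i hi)
      have hA' : A (i + 1) = (l (i + 1) / l i) • A i := by
        rw [hAdef]
        simp only [smul_smul]
        congr 1
        field_simp
      have h1 := cosetMeasure_smul_ge volume (Γ (i + 1)) (V (i + 1)) (fun γ h => h.2) (mA i)
        (cA i) hr fun p => by
          rw [← hA']
          exact cosetCount_ne_top_of_isBounded (hΓle _) (bA _) p
      rw [← hA'] at h1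
      rw [heq _ hi]
      refine le_trans ?_ h1
      have h2 := (ih hi').trans (cosetMeasure_le_of_le volume (hΓle (i + 1)) (A i))
      refine le_trans ?_ (mul_le_mul_right h2 _)
      rw [← mul_assoc]
      gcongr
      have hP : 0 ≤ ∏ j ∈ Finset.range i, l j :=
        Finset.prod_nonneg fun j hj => (hpos j (by have := Finset.mem_range.1 hj; omega)).le
      rw [← ENNReal.ofReal_mul (by positivity)]
      refine ENNReal.ofReal_le_ofReal ?_
      -- The codimension of $V_{i+1}$ is at least $n-(i+1)$ and the ratio is at least $1$.
      have h3 : (l (i + 1) / l i) ^ (n - (i + 1)) ≤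
          (l (i + 1) / l i) ^ (Module.finrank ℝ (Fin n → ℝ) - Module.finrank ℝ (V (i + 1))) :=
        pow_le_pow_right₀ hr (by have := hV _ hi; rw [Module.finrank_fin_fun]; omega)
      refine le_trans (le_of_eq ?_) (mul_le_mul_of_nonneg_right h3 (by positivity))
      obtain ⟨k, rfl⟩ : ∃ k, n = i + 1 + k := ⟨n - (i + 1), by omega⟩
      rw [Finset.prod_range_succ, show i + 1 + k - i = k + 1 by omega,
        show i + 1 + k - (i + 1) = k by omega, div_pow, pow_succ (l i)]
      field_simp
  rcases Nat.eq_zero_or_pos n with rfl | hn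
  · calc _ ≤ volume (Set.univ : Set (Fin 0 → ℝ)) := by
          simpa using measure_mono (Set.subset_univ U)
      _ = _ := by simp [volume_pi]
  · have h := (main (n - 1) (by omega)).trans (cosetMeasure_intLattice_le_one (mA _))
    have e : (∏ j ∈ Finset.range (n - 1), l j) * l (n - 1) ^ (n - (n - 1)) =
        ∏ i ∈ Finset.range n, l i := by
      conv_rhs => rw [← Nat.sub_add_cancel hn, Finset.prod_range_succ]
      rw [show n - (n - 1) = 1 by omega, pow_one]
    rw [e, ENNReal.ofReal_div_of_pos (by positivity), ENNReal.ofReal_pow (by norm_num),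
      ENNReal.ofReal_ofNat, mul_comm, ← mul_div_assoc, ENNReal.div_le_iff (by simp) (by simp),
      one_mul] at h
    rwa [mul_comm]

end MinkowskiSecond

/-! ### Counting integers in intervals and points in fibres -/

section IntervalCount

/-- If the interval $S$ contains no integer, it lies strictly between $z-1$ and $z$, and $S+[0,k]$
catches $z,\dots,z+k-1$. Otherwise let $q$ be its largest integer; $S$ stays below $q+1$, so the new
integers are $q+1,\dots,q+k$. -/
theorem ncard_intervalThickening {S : Set ℝ} (hS : S.OrdConnected) (hne : S.Nonempty)
    (hfin : {t : ℤ | (t : ℝ) ∈ S}.Finite) (k : ℕ) :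
    {t : ℤ | ∃ s ∈ S, s ≤ t ∧ (t : ℝ) ≤ s + k}.Finite ∧
      {t : ℤ | ∃ s ∈ S, s ≤ t ∧ (t : ℝ) ≤ s + k}.ncard = {t : ℤ | (t : ℝ) ∈ S}.ncard + k := by
  rcases {t : ℤ | (t : ℝ) ∈ S}.eq_empty_or_nonempty with h0 | h0
  · obtain ⟨s, hs⟩ := hne
    have hz1 := Int.le_ceil s
    have hz2 := Int.ceil_lt_add_one s
    set z := ⌈s⌉
    have hno : ∀ t : ℤ, (t : ℝ) ∉ S := fun t ht => by
      have : t ∈ {t : ℤ | (t : ℝ) ∈ S} := ht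
      simp [h0] at this
    have : {t : ℤ | ∃ s ∈ S, s ≤ t ∧ (t : ℝ) ≤ s + k} = Set.Ico z (z + k) := by
      ext t
      constructor
      · rintro ⟨s', hs', h1, h2⟩
        have h3 : ((z - 1 : ℤ) : ℝ) < s' := by
          by_contra! h
          refine hno (z - 1) (hS.out hs' hs ⟨h, ?_⟩)
          push_cast
          linarith
        have h4 : s' < z := by
          by_contra! h
          exact hno z (hS.out hs hs' ⟨hz1, h⟩)
        refine ⟨?_, ?_⟩
        · have : ((z - 1 : ℤ) : ℝ) < t := h3.trans_le h1
          have := Int.cast_lt.1 this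
          omega
        · have : (t : ℝ) < ((z + k : ℤ) : ℝ) := by
            push_cast
            linarith
          exact Int.cast_lt.1 this
      · rintro ⟨h1, h2⟩
        refine ⟨s, hs, hz1.trans (by exact_mod_cast h1), ?_⟩
        have : (t : ℝ) + 1 ≤ z + k := by exact_mod_cast h2
        linarith
    rw [this, h0]
    refine ⟨Set.finite_Ico _ _, ?_⟩
    rw [← Finset.coe_Ico, Set.ncard_coe_finset]
    simp
  · obtain ⟨q, hq, hmax⟩ := Set.exists_max_image _ id hfin h0
    have : {t : ℤ | ∃ s ∈ S, s ≤ t ∧ (t : ℝ) ≤ s + k} =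
        {t : ℤ | (t : ℝ) ∈ S} ∪ Set.Ioc q (q + k) := by
      ext t
      constructor
      · rintro ⟨s, hs, h1, h2⟩
        rcases le_or_gt t q with h | h
        · exact Or.inl (hS.out hs hq ⟨h1, by exact_mod_cast h⟩)
        · refine Or.inr ⟨h, ?_⟩
          have h3 : s < ((q + 1 : ℤ) : ℝ) := by
            by_contra! h3
            have := hmax (q + 1) (hS.out hq hs ⟨by push_cast; linarith, h3⟩)
            simp at this
          have : (t : ℝ) < ((q + 1 + k : ℤ) : ℝ) := by
            push_cast at h3 ⊢
            linarith
          have := Int.cast_lt.1 this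
          omega
      · rintro (h | ⟨h1, h2⟩)
        · exact ⟨t, h, le_rfl, by simp⟩
        · exact ⟨q, hq, by exact_mod_cast h1.le, by exact_mod_cast h2⟩
    rw [this]
    refine ⟨hfin.union (Set.finite_Ioc _ _), ?_⟩
    rw [Set.ncard_union_eq ?_ hfin (Set.finite_Ioc _ _), ← Finset.coe_Ioc, Set.ncard_coe_finset]
    · simp
    · refine Set.disjoint_left.2 fun t ht h => ?_
      have := hmax t ht
      simp only [id] at this
      exact absurd h.1 (by omega)

theorem ncard_eq_of_fibers {M N : Type*} (f : M → N) {A B : Set M} {C : Set N} (hA : A.Finite)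
    (hC : C.Finite) (hAB : A ⊆ B) (hBC : ∀ x ∈ B, f x ∈ C) (k : ℕ)
    (h : ∀ y ∈ C, (B ∩ f ⁻¹' {y}).Finite ∧
      (B ∩ f ⁻¹' {y}).ncard = (A ∩ f ⁻¹' {y}).ncard + k) :
    B.Finite ∧ B.ncard = A.ncard + k * C.ncard := by
  classical
  have hB : B.Finite := by
    refine Set.Finite.of_finite_fibers f (hC.subset ?_) ?_
    · rintro _ ⟨x, hx, rfl⟩
      exact hBC x hx
    · rintro _ ⟨x, hx, rfl⟩
      exact (h _ (hBC x hx)).1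
  refine ⟨hB, ?_⟩
  have key : ∀ D : Set M, D.Finite → (∀ x ∈ D, f x ∈ C) →
      D.ncard = ∑ y ∈ hC.toFinset, (D ∩ f ⁻¹' {y}).ncard := by
    intro D hD hDC
    rw [Set.ncard_eq_toFinset_card _ hD, Finset.card_eq_sum_card_fiberwise (f := f)
      (t := hC.toFinset) (fun x hx => by simpa using hDC x (by simpa using hx))]
    refine Finset.sum_congr rfl fun y _ => ?_
    rw [← Set.ncard_coe_finset]
    congr 1
    ext x
    simp
  rw [key B hB hBC, key A hA fun x hx => hBC x (hAB hx), Set.ncard_eq_toFinset_card _ hC]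
  rw [Finset.sum_congr rfl fun y hy => (h y (by simpa using hy)).2, Finset.sum_add_distrib]
  simp [mul_comm]

end IntervalCount

/-! ### Deletion-contraction for lattice points of zonotopes -/

section ZonotopePoints

variable {ι : Type*} {M : Type*} [AddCommGroup M]

/-- The points of the abelian group `M` that lie in the `k`-th dilate of the zonotope generated
by `v j`, `j ∈ s`, in `M ⊗ ℝ`. The latter space is seen through the functionals `M → ℝ`. -/
def zonotopePoints (v : ι → M) (s : Finset ι) (k : ℕ) : Set M :=
  {x | ∃ a : ι → ℝ, (∀ j ∈ s, 0 ≤ a j ∧ a j ≤ k) ∧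
    ∀ φ : M →ₗ[ℤ] ℝ, φ x = ∑ j ∈ s, a j * φ (v j)}

theorem map_torsion_eq_zero (φ : M →ₗ[ℤ] ℝ) {x : M} (hx : x ∈ Submodule.torsion ℤ M) :
    φ x = 0 := by
  obtain ⟨a, ha⟩ := (Submodule.mem_torsion_iff x).1 hx
  have h : (a : ℤ) • φ x = 0 := by
    rw [← map_smul]
    exact (congrArg φ ha).trans (map_zero φ)
  exact (smul_eq_zero.1 h).resolve_left (nonZeroDivisors.coe_ne_zero a)

/-- Modulo torsion the group is free, so some coordinate of $w$ is nonzero; real values allow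
rescaling it to $1$. -/
theorem exists_functional_eq_one [Module.Finite ℤ M] {w : M}
    (hw : w ∉ Submodule.torsion ℤ M) : ∃ φ : M →ₗ[ℤ] ℝ, φ w = 1 := by
  let Q := M ⧸ Submodule.torsion ℤ M
  have hq : (Submodule.torsion ℤ M).mkQ w ≠ 0 := by simpa using hw
  have : Module.Free ℤ Q := inferInstance
  let b := Module.Free.chooseBasis ℤ Q
  obtain ⟨i, hi⟩ : ∃ i, b.coord i ((Submodule.torsion ℤ M).mkQ w) ≠ 0 := by
    by_contra! h
    exact hq (b.forall_coord_eq_zero_iff.1 h)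
  set c := b.coord i ((Submodule.torsion ℤ M).mkQ w) with hc
  let ψ : M →ₗ[ℤ] ℝ := (Int.castAddHom ℝ).toIntLinearMap ∘ₗ b.coord i ∘ₗ
    (Submodule.torsion ℤ M).mkQ
  refine ⟨(LinearMap.mulLeft ℤ ((c : ℝ)⁻¹)) ∘ₗ ψ, ?_⟩
  have : ψ w = c := rfl
  simp [this, hi]

/-- Exactly the torsion elements are killed by all functionals. This is where torsion orders enter
the count. -/
theorem zonotopePoints_empty [Module.Finite ℤ M] (v : ι → M) (k : ℕ) :
    zonotopePoints v ∅ k = Submodule.torsion ℤ M := by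
  ext x
  constructor
  · rintro ⟨a, -, h⟩
    by_contra hx
    obtain ⟨φ, hφ⟩ := exists_functional_eq_one hx
    simpa [hφ] using h φ
  · intro hx
    exact ⟨0, by simp, fun φ => by simp [map_torsion_eq_zero φ hx]⟩

theorem zonotopePoints_insert_torsion [DecidableEq ι] (v : ι → M) {s : Finset ι} {i : ι}
    (hi : i ∉ s) (hw : v i ∈ Submodule.torsion ℤ M) (k : ℕ) :
    zonotopePoints v (insert i s) k = zonotopePoints v s k := by
  ext x
  constructor
  · rintro ⟨a, ha, h⟩
    refine ⟨a, fun j hj => ha j (Finset.mem_insert_of_mem hj), fun φ => ?_⟩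
    rw [h, Finset.sum_insert hi, map_torsion_eq_zero φ hw, mul_zero, zero_add]
  · rintro ⟨a, ha, h⟩
    have hne : ∀ j ∈ s, j ≠ i := fun j hj e => hi (e ▸ hj)
    refine ⟨Function.update a i 0, fun j hj => ?_, fun φ => ?_⟩
    · rcases Finset.mem_insert.1 hj with rfl | hj
      · simp
      · simpa [hne j hj] using ha j hj
    · rw [h, Finset.sum_insert hi, map_torsion_eq_zero φ hw, mul_zero, zero_add]
      exact Finset.sum_congr rfl fun j hj => by simp [hne j hj]

theorem zonotopePoints_subset_insert [DecidableEq ι] (v : ι → M) {s : Finset ι} {i : ι}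
    (hi : i ∉ s) (k : ℕ) : zonotopePoints v s k ⊆ zonotopePoints v (insert i s) k := by
  rintro x ⟨a, ha, h⟩
  have hne : ∀ j ∈ s, j ≠ i := fun j hj e => hi (e ▸ hj)
  refine ⟨Function.update a i 0, fun j hj => ?_, fun φ => ?_⟩
  · rcases Finset.mem_insert.1 hj with rfl | hj
    · simp
    · simpa [hne j hj] using ha j hj
  · rw [h, Finset.sum_insert hi]
    simp only [Function.update_self, zero_mul, zero_add]
    exact Finset.sum_congr rfl fun j hj => by simp [hne j hj]

/-- The fibre of the zonotope over `x`, in the direction `w`. -/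
def zonotopeFiber (v : ι → M) (s : Finset ι) (k : ℕ) (w x : M) : Set ℝ :=
  {t | ∃ a : ι → ℝ, (∀ j ∈ s, 0 ≤ a j ∧ a j ≤ k) ∧
    ∀ φ : M →ₗ[ℤ] ℝ, φ x + t * φ w = ∑ j ∈ s, a j * φ (v j)}

theorem convex_zonotopeFiber (v : ι → M) (s : Finset ι) (k : ℕ) (w x : M) :
    Convex ℝ (zonotopeFiber v s k w x) := by
  rintro t ⟨a, ha, h⟩ t' ⟨a', ha', h'⟩ c d hc hd hcd
  refine ⟨fun j => c * a j + d * a' j, fun j hj => ⟨?_, ?_⟩, fun φ => ?_⟩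
  · have := (ha j hj).1
    have := (ha' j hj).1
    positivity
  · calc c * a j + d * a' j ≤ c * k + d * k := by
          gcongr
          exacts [(ha j hj).2, (ha' j hj).2]
      _ = k := by rw [← add_mul, hcd, one_mul]
  · simp only [add_mul, Finset.sum_add_distrib, mul_assoc, ← Finset.mul_sum, ← h φ, ← h' φ,
      smul_eq_mul]
    linear_combination -(φ x) * hcd

theorem add_smul_mem_zonotopePoints_iff (v : ι → M) (s : Finset ι) (k : ℕ) (w x : M) (t : ℤ) :
    x + t • w ∈ zonotopePoints v s k ↔ (t : ℝ) ∈ zonotopeFiber v s k w x := by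
  simp [zonotopePoints, zonotopeFiber]

/-- Moving the term of `v i` to the other side turns its coefficient into $t - r$, with $r$ in the
old fibre; the condition is $0 \le t-r \le k$. -/
theorem add_smul_mem_zonotopePoints_insert_iff [DecidableEq ι] (v : ι → M) {s : Finset ι} {i : ι}
    (hi : i ∉ s) (k : ℕ) (x : M) (t : ℤ) :
    x + t • v i ∈ zonotopePoints v (insert i s) k ↔
      ∃ r ∈ zonotopeFiber v s k (v i) x, r ≤ t ∧ (t : ℝ) ≤ r + k := by
  constructor
  · rintro ⟨a, ha, h⟩
    have hai := ha i (Finset.mem_insert_self i s)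
    refine ⟨t - a i, ⟨a, fun j hj => ha j (Finset.mem_insert_of_mem hj), fun φ => ?_⟩,
      by linarith, by linarith⟩
    have := h φ
    rw [Finset.sum_insert hi, map_add, map_zsmul, zsmul_eq_mul] at this
    linear_combination this
  · rintro ⟨r, ⟨a, ha, h⟩, h1, h2⟩
    have hne : ∀ j ∈ s, j ≠ i := fun j hj e => hi (e ▸ hj)
    refine ⟨Function.update a i (t - r), fun j hj => ?_, fun φ => ?_⟩
    · rcases Finset.mem_insert.1 hj with rfl | hj
      · simp only [Function.update_self]
        exact ⟨by linarith, by linarith⟩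
      · simpa [hne j hj] using ha j hj
    · have e : ∑ j ∈ s, Function.update a i (t - r) j * φ (v j) = ∑ j ∈ s, a j * φ (v j) :=
        Finset.sum_congr rfl fun j hj => by simp [hne j hj]
      rw [Finset.sum_insert hi, e, ← h φ, map_add, map_zsmul, zsmul_eq_mul,
        Function.update_self]
      ring

/-- For the converse, fix $\psi$ with $\psi(w)=1$. Each $\varphi - \varphi(w)\psi$ kills $w$ and
descends to the quotient, and the parameter $t$ is what $\psi$ forces it to be. -/
theorem zonotopeFiber_nonempty_iff [Module.Finite ℤ M] (v : ι → M) (s : Finset ι) (k : ℕ)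
    {w : M} (hw : w ∉ Submodule.torsion ℤ M) (x : M) :
    (zonotopeFiber v s k w x).Nonempty ↔
      (ℤ ∙ w).mkQ x ∈ zonotopePoints ((ℤ ∙ w).mkQ ∘ v) s k := by
  constructor
  · rintro ⟨t, a, ha, h⟩
    refine ⟨a, ha, fun φ => ?_⟩
    have hφw : φ ((ℤ ∙ w).mkQ w) = 0 := by
      have : (ℤ ∙ w).mkQ w = 0 := by simp [Submodule.mem_span_singleton_self]
      rw [this, map_zero]
    have := h (φ ∘ₗ (ℤ ∙ w).mkQ)
    simpa only [LinearMap.comp_apply, Function.comp_apply, hφw, mul_zero, add_zero] using this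
  · rintro ⟨a, ha, h⟩
    obtain ⟨ψ, hψ⟩ := exists_functional_eq_one hw
    refine ⟨∑ j ∈ s, a j * ψ (v j) - ψ x, a, ha, fun φ => ?_⟩
    let χ : M →ₗ[ℤ] ℝ := φ - LinearMap.mulLeft ℤ (φ w) ∘ₗ ψ
    have hχ : ∀ y, χ y = φ y - φ w * ψ y := fun y => by simp [χ]
    have hker : ℤ ∙ w ≤ LinearMap.ker χ := by
      rw [Submodule.span_singleton_le_iff_mem, LinearMap.mem_ker, hχ, hψ]
      ring
    have := h ((ℤ ∙ w).liftQ χ hker)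
    simp only [Function.comp_apply, Submodule.mkQ_apply, Submodule.liftQ_apply, hχ, mul_sub,
      Finset.sum_sub_distrib] at this
    have e : ∑ j ∈ s, a j * (φ w * ψ (v j)) = φ w * ∑ j ∈ s, a j * ψ (v j) := by
      rw [Finset.mul_sum]
      exact Finset.sum_congr rfl fun j _ => by ring
    rw [e] at this
    linear_combination this

theorem zsmul_injective_of_notMem_torsion {w : M} (hw : w ∉ Submodule.torsion ℤ M) (x : M) :
    Function.Injective fun t : ℤ => x + t • w := by
  intro t t' h
  by_contra hne
  refine hw ((Submodule.mem_torsion_iff w).2 ⟨⟨t - t', by simpa [sub_eq_zero] using hne⟩, ?_⟩)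
  have : t • w = t' • w := add_left_cancel h
  change (t - t') • w = 0
  rw [sub_smul, this, sub_self]

/-- Deletion-contraction for the number of lattice points of a zonotope. -/
theorem ncard_zonotopePoints_insert [DecidableEq ι] [Module.Finite ℤ M] (v : ι → M)
    {s : Finset ι} {i : ι} (hi : i ∉ s) (hw : v i ∉ Submodule.torsion ℤ M) (k : ℕ)
    (h1 : (zonotopePoints v s k).Finite)
    (h2 : (zonotopePoints ((ℤ ∙ v i).mkQ ∘ v) s k).Finite) :
    (zonotopePoints v (insert i s) k).Finite ∧
      (zonotopePoints v (insert i s) k).ncard = (zonotopePoints v s k).ncard +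
        k * (zonotopePoints ((ℤ ∙ v i).mkQ ∘ v) s k).ncard := by
  have hmk : ∀ x y : M, (ℤ ∙ v i).mkQ y = (ℤ ∙ v i).mkQ x ↔ ∃ t : ℤ, x + t • v i = y := by
    intro x y
    rw [Submodule.mkQ_apply, Submodule.mkQ_apply, Submodule.Quotient.eq,
      Submodule.mem_span_singleton]
    exact exists_congr fun t => by rw [eq_sub_iff_add_eq, add_comm]
  -- Over each point of the contracted zonotope, the line $x + \mathbb{Z}v_i$ gains exactly $k$
  -- points.
  refine ncard_eq_of_fibers (ℤ ∙ v i).mkQ h1 h2 (zonotopePoints_subset_insert v hi k) ?_ k ?_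
  · intro x hx
    rw [← zonotopeFiber_nonempty_iff v s k hw]
    obtain ⟨r, hr, -⟩ := (add_smul_mem_zonotopePoints_insert_iff v hi k x 0).1 (by simpa using hx)
    exact ⟨r, hr⟩
  · intro y hy
    obtain ⟨x, rfl⟩ := (ℤ ∙ v i).mkQ_surjective y
    have hinj := zsmul_injective_of_notMem_torsion hw x
    have hfib : ∀ A : Set M, A ∩ (ℤ ∙ v i).mkQ ⁻¹' {(ℤ ∙ v i).mkQ x} =
        (fun t : ℤ => x + t • v i) '' {t | x + t • v i ∈ A} := by
      intro A
      ext z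
      simp only [Set.mem_inter_iff, Set.mem_preimage, Set.mem_singleton_iff, hmk, Set.mem_image,
        Set.mem_ofPred_eq]
      constructor
      · rintro ⟨hz, t, rfl⟩
        exact ⟨t, hz, rfl⟩
      · rintro ⟨t, hz, rfl⟩
        exact ⟨hz, t, rfl⟩
    have hS := (convex_zonotopeFiber v s k (v i) x).ordConnected
    have hne := (zonotopeFiber_nonempty_iff v s k hw x).2 hy
    have hfin : {t : ℤ | (t : ℝ) ∈ zonotopeFiber v s k (v i) x}.Finite := by
      simp only [← add_smul_mem_zonotopePoints_iff]
      exact Set.Finite.preimage hinj.injOn h1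
    have := ncard_intervalThickening hS hne hfin k
    rw [hfib, hfib, Set.ncard_image_of_injective _ hinj, Set.ncard_image_of_injective _ hinj]
    simp only [add_smul_mem_zonotopePoints_insert_iff v hi, add_smul_mem_zonotopePoints_iff]
    exact ⟨this.1.image _, this.2⟩

end ZonotopePoints

/-! ### The counting polynomial and its coefficients -/

section ZonotopePolynomial

universe u

variable {ι : Type*}

/-- Every subfamily of `v j`, `j ∈ s`, of size `r` is independent over `ℤ`. -/
def IndependentSubfamilies {M : Type*} [AddCommGroup M] (v : ι → M) (s : Finset ι) (r : ℕ) :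
    Prop :=
  ∀ J ⊆ s, J.card = r → ∀ c : ι → ℤ, ∑ j ∈ J, c j • v j = 0 → ∀ j ∈ J, c j = 0

theorem IndependentSubfamilies.mono {M : Type*} [AddCommGroup M] {v : ι → M} {s t : Finset ι}
    {r : ℕ} (h : IndependentSubfamilies v t r) (hst : s ⊆ t) : IndependentSubfamilies v s r :=
  fun J hJ => h J (hJ.trans hst)

/-- A relation in the quotient lifts to one in $M$ with an extra multiple of `v i`, so it involves
$r+1$ vectors. -/
theorem IndependentSubfamilies.quotient [DecidableEq ι] {M : Type*} [AddCommGroup M] {v : ι → M}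
    {s : Finset ι} {r : ℕ} {i : ι} (hi : i ∉ s)
    (h : IndependentSubfamilies v (insert i s) (r + 1)) :
    IndependentSubfamilies ((ℤ ∙ v i).mkQ ∘ v) s r := by
  intro J hJ hcard c hc j hj
  have hiJ : i ∉ J := fun hiJ => hi (hJ hiJ)
  have hne : ∀ j ∈ J, j ≠ i := fun j hj e => hiJ (e ▸ hj)
  have h0 : (ℤ ∙ v i).mkQ (∑ j ∈ J, c j • v j) = 0 := by
    rw [map_sum, ← hc]
    exact Finset.sum_congr rfl fun j _ => by simp
  rw [Submodule.mkQ_apply, Submodule.Quotient.mk_eq_zero, Submodule.mem_span_singleton] at h0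
  obtain ⟨d, hd⟩ := h0
  have := h (insert i J) (Finset.insert_subset_insert i hJ)
    (by rw [Finset.card_insert_of_notMem hiJ, hcard]) (Function.update c i (-d)) ?_ j
    (Finset.mem_insert_of_mem hj)
  · simpa [hne j hj] using this
  · have e : ∑ j ∈ J, Function.update c i (-d) j • v j = ∑ j ∈ J, c j • v j :=
      Finset.sum_congr rfl fun j hj => by simp [hne j hj]
    rw [Finset.sum_insert hiJ, e, ← hd]
    simp

/-- Complete $i$ to an $r$-element subset; a torsion relation on `v i` alone is a nontrivial
relation there. -/
theorem IndependentSubfamilies.notMem_torsion {M : Type*} [AddCommGroup M] {v : ι → M}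
    {s : Finset ι} {r : ℕ} {i : ι} (h : IndependentSubfamilies v s r) (hi : i ∈ s)
    (hr : 1 ≤ r) (hrs : r ≤ s.card) : v i ∉ Submodule.torsion ℤ M := by
  classical
  intro hw
  obtain ⟨a, ha⟩ := (Submodule.mem_torsion_iff _).1 hw
  obtain ⟨J, h1, h2, h3⟩ := Finset.exists_subsuperset_card_eq
    (Finset.singleton_subset_iff.2 hi) (by simpa using hr) hrs
  have hiJ : i ∈ J := Finset.singleton_subset_iff.1 h1
  have := h J h2 h3 (Pi.single i (a : ℤ)) ?_ i hiJ
  · exact nonZeroDivisors.coe_ne_zero a (by rwa [Pi.single_eq_same] at this)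
  · rw [Finset.sum_eq_single_of_mem i hiJ fun j _ hj => by simp [hj]]
    rw [Pi.single_eq_same]
    exact ha

theorem finrank_quotient_span_singleton_add_one {M : Type*} [AddCommGroup M] [Module.Finite ℤ M]
    {w : M} (hw : w ∉ Submodule.torsion ℤ M) :
    Module.finrank ℤ (M ⧸ (ℤ ∙ w)) + 1 = Module.finrank ℤ M := by
  rw [← Submodule.finrank_quotient_add_finrank (ℤ ∙ w)]
  congr 1
  have hinj := zsmul_injective_of_notMem_torsion hw 0
  have : Function.Injective (LinearMap.toSpanSingleton ℤ M w) := fun a b h =>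
    hinj (by simpa using h)
  rw [← LinearMap.range_toSpanSingleton, LinearMap.finrank_range_of_inj this,
    Module.finrank_self]

theorem finite_torsion (M : Type*) [AddCommGroup M] [Module.Finite ℤ M] :
    Finite (Submodule.torsion ℤ M) :=
  Module.finite_of_fg_torsion _ (Submodule.torsion_isTorsion)

/-- The lattice points in the dilates of a zonotope are counted by a polynomial. -/
theorem exists_polynomial_ncard_zonotopePoints [DecidableEq ι] (s : Finset ι) :
    ∀ (M : Type u) [AddCommGroup M] [Module.Finite ℤ M] (v : ι → M),
      (∀ k, (zonotopePoints v s k).Finite) ∧ ∃ p : Polynomial ℝ,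
        p.natDegree ≤ Module.finrank ℤ M ∧
        (∀ k : ℕ, ((zonotopePoints v s k).ncard : ℝ) = p.eval (k : ℝ)) ∧
        p.coeff 0 = Nat.card (Submodule.torsion ℤ M) ∧
        ((∀ j ∈ s, v j ∉ Submodule.torsion ℤ M) →
          p.coeff 1 = ∑ j ∈ s, (Nat.card (Submodule.torsion ℤ (M ⧸ (ℤ ∙ v j))) : ℝ)) ∧
        0 ≤ p.coeff (Module.finrank ℤ M) ∧
        (IndependentSubfamilies v s (Module.finrank ℤ M) →
          (s.card.choose (Module.finrank ℤ M) : ℝ) ≤ p.coeff (Module.finrank ℤ M)) := by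
  -- The group stays quantified because the hypothesis is used for both $M$ and $M/\mathbb{Z}v_i$.
  induction s using Finset.induction_on with
  | empty =>
    intro M _ _ v
    have hfin := finite_torsion M
    refine ⟨fun k => ?_, Polynomial.C (Nat.card (Submodule.torsion ℤ M) : ℝ), by simp,
      fun k => ?_, by simp, fun _ => by simp, ?_, fun _ => ?_⟩
    · rw [zonotopePoints_empty]
      exact Set.toFinite _
    · rw [zonotopePoints_empty, Polynomial.eval_C]
      rfl
    · rw [Polynomial.coeff_C]
      split_ifs <;> simp
    · rw [Polynomial.coeff_C]
      split_ifs with h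
      · rw [h]
        have : 0 < Nat.card (Submodule.torsion ℤ M) := Nat.card_pos
        rw [Finset.card_empty, Nat.choose_self]
        exact_mod_cast this
      · simp [Nat.choose_eq_zero_of_lt (Nat.pos_of_ne_zero h)]
  | insert i s hi ih =>
    intro M _ _ v
    obtain ⟨hf, p, hdeg, hp, h0, h1, hr0, hr⟩ := ih M v
    by_cases hw : v i ∈ Submodule.torsion ℤ M
    · simp only [zonotopePoints_insert_torsion v hi hw]
      refine ⟨hf, p, hdeg, hp, h0, fun h => absurd hw (h i (Finset.mem_insert_self i s)), hr0,
        fun h => ?_⟩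
      -- In rank $0$ both binomials are $1$; in rank above $|s|+1$ the binomial vanishes; in
      -- between, independence excludes a torsion generator.
      rcases Nat.eq_zero_or_pos (Module.finrank ℤ M) with hz | hz
      · simpa [hz] using hr (h.mono (Finset.subset_insert i s))
      · rcases le_or_gt (Module.finrank ℤ M) (insert i s).card with hc | hc
        · exact absurd hw (h.notMem_torsion (Finset.mem_insert_self i s) hz hc)
        · simpa [Nat.choose_eq_zero_of_lt hc] using hr0
    · obtain ⟨hf', p', hdeg', hp', h0', -, hr0', hr'⟩ :=
        ih (M ⧸ (ℤ ∙ v i)) ((ℤ ∙ v i).mkQ ∘ v)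
      have hrank := finrank_quotient_span_singleton_add_one hw
      rw [← hrank] at hdeg hr0 hr ⊢
      set r := Module.finrank ℤ (M ⧸ (ℤ ∙ v i))
      have hins := fun k => ncard_zonotopePoints_insert v hi hw k (hf k) (hf' k)
      -- The factor $X$ moves the constant term of the contraction, a torsion order, into the linear
      -- coefficient, and its top coefficient into the top one, where the bounds add by Pascal's
      -- rule.
      refine ⟨fun k => (hins k).1, p + Polynomial.X * p', ?_, fun k => ?_, ?_, fun h => ?_, ?_,
        fun h => ?_⟩
      · refine Polynomial.natDegree_add_le_of_degree_le hdeg ?_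
        refine Polynomial.natDegree_mul_le.trans ?_
        rw [Polynomial.natDegree_X]
        omega
      · rw [(hins k).2, Polynomial.eval_add, Polynomial.eval_mul, Polynomial.eval_X, ← hp, ← hp']
        push_cast
        ring
      · simp [h0]
      · rw [Polynomial.coeff_add, Polynomial.coeff_X_mul, h0',
          h1 fun j hj => h j (Finset.mem_insert_of_mem hj), Finset.sum_insert hi, add_comm]
      · rw [Polynomial.coeff_add, Polynomial.coeff_X_mul]
        positivity
      · rw [Polynomial.coeff_add, Polynomial.coeff_X_mul, Finset.card_insert_of_notMem hi,
          Nat.choose_succ_succ, Nat.cast_add, add_comm]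
        exact add_le_add (hr (h.mono (Finset.subset_insert i s))) (hr' (h.quotient hi))

end ZonotopePolynomial

/-! ### Ehrhart polynomial, volume and difference body of the zonotope -/

section ZonotopeEhrhart

open MeasureTheory Filter Topology

variable {n m : ℕ}

theorem toRealVec_injective : Function.Injective (toRealVec (n := n)) := fun _ _ h =>
  funext fun i => Int.cast_injective (α := ℝ) (congrFun h i)

theorem apply_eq_sum_of_intLinear (φ : (Fin n → ℤ) →ₗ[ℤ] ℝ) (x : Fin n → ℤ) :
    φ x = ∑ i, (x i : ℝ) * φ (Pi.single i 1) := by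
  conv_lhs => rw [pi_eq_sum_univ' x, map_sum]
  exact Finset.sum_congr rfl fun i _ => by rw [map_zsmul, zsmul_eq_mul]

theorem smul_latticeZonotope_inter_intLattice (v : Fin m → Fin n → ℤ) (k : ℕ) :
    ((k : ℝ) • latticeZonotope v) ∩ intLattice n =
      toRealVec '' zonotopePoints v Finset.univ k := by
  ext x
  constructor
  · rintro ⟨⟨_, ⟨a, ha, rfl⟩, hx⟩, z, rfl⟩
    refine ⟨z, ⟨fun j => k * a j, fun j _ => ⟨mul_nonneg (by positivity) (ha j).1,
      mul_le_of_le_one_right (by positivity) (ha j).2⟩, fun φ => ?_⟩, rfl⟩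
    have hz : ∀ i, (z i : ℝ) = ∑ j, k * a j * (v j i : ℝ) := fun i => by
      have := congrFun hx i
      simp only [Pi.smul_apply, Finset.sum_apply, smul_eq_mul, toRealVec] at this
      rw [← this, Finset.mul_sum]
      exact Finset.sum_congr rfl fun j _ => by ring
    rw [apply_eq_sum_of_intLinear]
    simp_rw [hz, apply_eq_sum_of_intLinear φ (v _), Finset.sum_mul, Finset.mul_sum]
    rw [Finset.sum_comm]
    exact Finset.sum_congr rfl fun j _ => Finset.sum_congr rfl fun i _ => by ring
  · rintro ⟨z, ⟨a, ha, h⟩, rfl⟩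
    refine ⟨?_, z, rfl⟩
    have hz : toRealVec z = ∑ j, a j • toRealVec (v j) := by
      ext i
      have := h ((Int.castAddHom ℝ).toIntLinearMap ∘ₗ LinearMap.proj i)
      simpa [toRealVec] using this
    -- For $k = 0$ the coefficients cannot be divided by $k$, but all of them vanish.
    rcases Nat.eq_zero_or_pos k with rfl | hk
    · have h0 : ∀ j, a j = 0 := fun j =>
        le_antisymm (by simpa using (ha j (Finset.mem_univ j)).2) (ha j (Finset.mem_univ j)).1
      refine ⟨0, ⟨0, fun j => by simp, by simp⟩, ?_⟩
      rw [hz]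
      simp [h0]
    · have hk' : (0 : ℝ) < k := by exact_mod_cast hk
      refine ⟨_, ⟨fun j => a j / k, fun j => ⟨div_nonneg (ha j (Finset.mem_univ j)).1 hk'.le,
        div_le_one_of_le₀ (ha j (Finset.mem_univ j)).2 hk'.le⟩, rfl⟩, ?_⟩
      simp only [hz, Finset.smul_sum, smul_smul]
      exact Finset.sum_congr rfl fun j _ => by rw [mul_div_cancel₀ _ hk'.ne']

theorem latticePointCount_smul_latticeZonotope (v : Fin m → Fin n → ℤ) (k : ℕ) :
    latticePointCount ((k : ℝ) • latticeZonotope v) =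
      (zonotopePoints v Finset.univ k).ncard := by
  rw [latticePointCount, smul_latticeZonotope_inter_intLattice,
    Set.ncard_image_of_injective _ toRealVec_injective]

theorem IsPrimitiveVec.notMem_torsion {w : Fin n → ℤ} (hw : IsPrimitiveVec w) :
    w ∉ Submodule.torsion ℤ (Fin n → ℤ) := by
  rw [(Submodule.isTorsionFree_iff_torsion_eq_bot).1 inferInstance, Submodule.mem_bot]
  rintro rfl
  have : Finset.univ.gcd (0 : Fin n → ℤ) = 0 := Finset.gcd_eq_zero_iff.2 fun _ _ => rfl
  exact zero_ne_one (this.symm.trans hw)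

/-- If $ay = dw$ with $a \ne 0$, then $a$ divides the gcd of the $d\,w_i$, which is $d$ up to sign;
cancelling $a$ puts $y$ in $\mathbb{Z}w$. -/
theorem IsPrimitiveVec.torsion_quotient_eq_bot {w : Fin n → ℤ} (hw : IsPrimitiveVec w) :
    Submodule.torsion ℤ ((Fin n → ℤ) ⧸ (ℤ ∙ w)) = ⊥ := by
  refine (Submodule.eq_bot_iff _).2 fun y hy => ?_
  obtain ⟨y, rfl⟩ := (ℤ ∙ w).mkQ_surjective y
  obtain ⟨a, ha⟩ := (Submodule.mem_torsion_iff _).1 hy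
  have ha' : (ℤ ∙ w).mkQ ((a : ℤ) • y) = 0 := by
    rw [map_smul]
    exact ha
  have ha0 : (a : ℤ) ≠ 0 := nonZeroDivisors.coe_ne_zero a
  rw [Submodule.mkQ_apply, Submodule.Quotient.mk_eq_zero, Submodule.mem_span_singleton] at ha'
  obtain ⟨d, hd⟩ := ha'
  have hdvd : (a : ℤ) ∣ d := by
    have : (a : ℤ) ∣ Finset.univ.gcd fun i => d * w i :=
      Finset.dvd_gcd fun i _ => ⟨y i, by simpa using congrFun hd i⟩
    rw [Finset.gcd_mul_left, show Finset.univ.gcd w = 1 from hw, mul_one] at this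
    exact this.trans (normalize_associated d).dvd
  obtain ⟨e, rfl⟩ := hdvd
  rw [Submodule.mkQ_apply, Submodule.Quotient.mk_eq_zero, Submodule.mem_span_singleton]
  refine ⟨e, ?_⟩
  rw [mul_smul] at hd
  exact smul_right_injective _ ha0 hd

theorem InGeneralPosition.independentSubfamilies {v : Fin m → Fin n → ℤ}
    (h : InGeneralPosition v) : IndependentSubfamilies v Finset.univ n := by
  intro J _ hcard c hc j hj
  have := Fintype.linearIndependent_iff.1 (h J hcard) (fun j => (c j : ℝ)) ?_ ⟨j, hj⟩
  · exact_mod_cast this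
  · rw [Finset.sum_coe_sort J fun j => (c j : ℝ) • toRealVec (v j)]
    ext i
    have := congrFun hc i
    simp only [Finset.sum_apply, Pi.smul_apply, smul_eq_mul, Pi.zero_apply, toRealVec] at this ⊢
    exact_mod_cast this

/-- The Ehrhart polynomial of a zonotope generated by primitive vectors in general position. -/
theorem exists_ehrhartPolynomial_latticeZonotope {v : Fin m → Fin n → ℤ}
    (hprim : ∀ j, IsPrimitiveVec (v j)) (hgen : InGeneralPosition v) :
    ∃ p : Polynomial ℝ, IsEhrhartPolynomial (latticeZonotope v) p ∧ p.coeff 1 = m ∧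
      (m.choose n : ℝ) ≤ p.coeff n := by
  obtain ⟨-, p, hdeg, hp, -, h1, -, hn⟩ :=
    exists_polynomial_ncard_zonotopePoints Finset.univ (Fin n → ℤ) v
  rw [Module.finrank_fin_fun] at hdeg hn
  refine ⟨p, ⟨hdeg, fun k => ?_⟩, ?_, ?_⟩
  · rw [latticePointCount_smul_latticeZonotope, hp]
  · rw [h1 fun j _ => (hprim j).notMem_torsion]
    simp only [(hprim _).torsion_quotient_eq_bot]
    simp
  · simpa using hn hgen.independentSubfamilies

theorem latticeZonotope_eq_image (v : Fin m → Fin n → ℤ) :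
    latticeZonotope v =
      Fintype.linearCombination ℝ (fun j => toRealVec (v j)) '' Set.Icc 0 1 := by
  ext x
  constructor
  · rintro ⟨a, ha, rfl⟩
    exact ⟨a, ⟨fun j => (ha j).1, fun j => (ha j).2⟩, by simp [Fintype.linearCombination_apply]⟩
  · rintro ⟨a, ha, rfl⟩
    exact ⟨a, fun j => ⟨ha.1 j, ha.2 j⟩, by simp [Fintype.linearCombination_apply]⟩

theorem isCompact_latticeZonotope (v : Fin m → Fin n → ℤ) : IsCompact (latticeZonotope v) := by
  rw [latticeZonotope_eq_image]
  exact isCompact_Icc.image (LinearMap.continuous_of_finiteDimensional _)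

theorem convex_latticeZonotope (v : Fin m → Fin n → ℤ) : Convex ℝ (latticeZonotope v) := by
  rw [latticeZonotope_eq_image]
  exact (convex_Icc 0 1).linear_image _

/-- Differences $a - b$ of coefficients in $[0,1]$ fill $[-1,1]$, which is also the range of $2c -
1$; take $c = (a-b+1)/2$, and conversely $b = 1-a$. -/
theorem latticeZonotope_sub_self (v : Fin m → Fin n → ℤ) :
    latticeZonotope v - latticeZonotope v =
      (-∑ j, toRealVec (v j)) +ᵥ ((2 : ℝ) • latticeZonotope v) := by
  ext x
  constructor
  · rintro ⟨_, ⟨a, ha, rfl⟩, _, ⟨b, hb, rfl⟩, rfl⟩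
    refine ⟨_, ⟨_, ⟨fun j => (a j - b j + 1) / 2, fun j => ⟨?_, ?_⟩, rfl⟩, rfl⟩, ?_⟩
    · linarith [(ha j).1, (hb j).2]
    · linarith [(ha j).2, (hb j).1]
    · simp only [Finset.smul_sum, smul_smul, ← Finset.sum_sub_distrib, vadd_eq_add,
        ← Finset.sum_neg_distrib, ← Finset.sum_add_distrib]
      refine Finset.sum_congr rfl fun j _ => ?_
      module
  · rintro ⟨_, ⟨_, ⟨a, ha, rfl⟩, rfl⟩, rfl⟩
    refine ⟨_, ⟨a, ha, rfl⟩, _, ⟨fun j => 1 - a j, fun j => ⟨?_, ?_⟩, rfl⟩, ?_⟩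
    · linarith [(ha j).2]
    · linarith [(ha j).1]
    · simp only [Finset.smul_sum, smul_smul, ← Finset.sum_sub_distrib, vadd_eq_add,
        ← Finset.sum_neg_distrib, ← Finset.sum_add_distrib]
      refine Finset.sum_congr rfl fun j _ => ?_
      module

theorem volume_latticeZonotope_sub_self (v : Fin m → Fin n → ℤ) :
    volume (latticeZonotope v - latticeZonotope v) = 2 ^ n * volume (latticeZonotope v) := by
  rw [latticeZonotope_sub_self, measure_vadd, Measure.addHaar_smul, Module.finrank_fin_fun,
    abs_of_nonneg (by positivity), ENNReal.ofReal_pow (by norm_num), ENNReal.ofReal_ofNat]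

theorem tendsto_eval_div_pow_coeff {p : Polynomial ℝ} (hp : p.natDegree ≤ n) :
    Tendsto (fun x : ℝ => p.eval x / x ^ n) atTop (𝓝 (p.coeff n)) := by
  have hX : ((Polynomial.X : Polynomial ℝ) ^ n).degree = n := Polynomial.degree_X_pow n
  rcases eq_or_ne (p.coeff n) 0 with h0 | h0
  · have hlt : p.degree < ((Polynomial.X : Polynomial ℝ) ^ n).degree := by
      rw [hX]
      refine lt_of_le_of_ne (Polynomial.natDegree_le_iff_degree_le.1 hp) fun h => ?_
      exact Polynomial.coeff_ne_zero_of_eq_degree h h0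
    have := Polynomial.div_tendsto_atTop_zero_of_degree_lt p _ hlt
    simpa [h0] using this
  · have hdeg : p.natDegree = n := le_antisymm hp (Polynomial.le_natDegree_of_ne_zero h0)
    have heq : p.degree = ((Polynomial.X : Polynomial ℝ) ^ n).degree := by
      rw [hX, ← hdeg, Polynomial.degree_eq_natDegree]
      rintro rfl
      simp at h0
    have := Polynomial.div_tendsto_atTop_leadingCoeff_div_of_degree_eq p _ heq
    simpa [Polynomial.leadingCoeff, hdeg] using this

/-- The leading Ehrhart coefficient is the volume. -/
theorem volume_eq_coeff_of_isEhrhartPolynomial {P : Set (Fin n → ℝ)} (hP : IsCompact P)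
    (hconv : Convex ℝ P) {p : Polynomial ℝ} (hp : IsEhrhartPolynomial P p) :
    volume.real P = p.coeff n := by
  have h1 := tendsto_card_div_pow_atTop_volume P hP.isBounded hP.measurableSet
    (hconv.addHaar_frontier volume)
  have h2 := (tendsto_eval_div_pow_coeff hp.1).comp (tendsto_natCast_atTop_atTop (R := ℝ))
  refine tendsto_nhds_unique_of_eventuallyEq h1 h2 ?_
  filter_upwards [eventually_gt_atTop 0] with k hk
  have hk' : (k : ℝ) ≠ 0 := by exact_mod_cast hk.ne'
  rw [Function.comp_apply, ← hp.2 k, Fintype.card_fin, latticePointCount, Nat.card_coe_set_eq,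
    span_basisFun_eq_intLattice]
  congr 2
  -- The limit counts points of $P \cap k^{-1}\mathbb{Z}^n$; scaling by $k$ turns them into those of
  -- $kP \cap \mathbb{Z}^n$.
  rw [← Set.ncard_image_of_injective (P ∩ _) (smul_right_injective _ hk'), Set.image_smul,
    Set.smul_set_inter₀ hk', smul_inv_smul₀ hk']

end ZonotopeEhrhart

/-! ### Successive minima of convex bodies -/

section SuccessiveMinima

open MeasureTheory Filter Topology

variable {n : ℕ}

theorem affDim_eq_finrank_span {S : Set (Fin n → ℝ)} (h : 0 ∈ S) :
    affDim S = Module.finrank ℝ (Submodule.span ℝ S) := by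
  have hS : (· -ᵥ (0 : Fin n → ℝ)) '' S = S := by simp
  rw [affDim, direction_affineSpan, vectorSpan_eq_span_vsub_set_right ℝ h, hS]

theorem affDim_mono {S T : Set (Fin n → ℝ)} (h : S ⊆ T) : affDim S ≤ affDim T :=
  Submodule.finrank_mono (AffineSubspace.direction_le (affineSpan_mono ℝ h))

theorem zero_mem_intLattice : (0 : Fin n → ℝ) ∈ intLattice n := ⟨0, by ext; simp⟩

theorem smul_subset_smul_of_le {K : Set (Fin n → ℝ)} (hconv : Convex ℝ K) (h0 : 0 ∈ K) {r t : ℝ}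
    (hr : 0 < r) (hrt : r ≤ t) : r • K ⊆ t • K := by
  have ht : 0 < t := hr.trans_le hrt
  rintro _ ⟨x, hx, rfl⟩
  refine ⟨(r / t) • x, hconv.smul_mem_of_zero_mem h0 hx ⟨by positivity, (div_le_one ht).2 hrt⟩, ?_⟩
  simp only [smul_smul, mul_div_cancel₀ _ ht.ne']

theorem minimaSet_nonempty {K : Set (Fin n → ℝ)} (hK : 0 ∈ interior K) {i : ℕ} (hi : i ≤ n) :
    (minimaSet K i).Nonempty := by
  have h : ∀ᶠ t : ℝ in 𝓝 0, ∀ j : Fin n, t • (Pi.single j 1 : Fin n → ℝ) ∈ K := by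
    refine eventually_all.2 fun j => ?_
    have hc : Tendsto (fun t : ℝ => t • (Pi.single j 1 : Fin n → ℝ)) (𝓝 0) (𝓝 0) := by
      have : Continuous fun t : ℝ => t • (Pi.single j 1 : Fin n → ℝ) := by fun_prop
      simpa using this.tendsto 0
    exact hc (mem_interior_iff_mem_nhds.1 hK)
  obtain ⟨t, ht, ht0⟩ := ((h.filter_mono nhdsWithin_le_nhds).and
    (self_mem_nhdsWithin : ∀ᶠ t in 𝓝[>] (0 : ℝ), t ∈ Set.Ioi 0)).exists
  have ht0 : 0 < t := ht0
  refine ⟨t⁻¹, inv_pos.2 ht0, ?_⟩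
  have hmem0 : (0 : Fin n → ℝ) ∈ (t⁻¹ • K) ∩ intLattice n :=
    ⟨⟨0, interior_subset hK, by simp⟩, zero_mem_intLattice⟩
  rw [affDim_eq_finrank_span hmem0]
  have htop : Submodule.span ℝ ((t⁻¹ • K) ∩ intLattice n) = ⊤ := by
    rw [eq_top_iff, ← (Pi.basisFun ℝ (Fin n)).span_eq]
    refine Submodule.span_mono ?_
    rintro _ ⟨j, rfl⟩
    rw [Pi.basisFun_apply]
    refine ⟨⟨_, ht j, ?_⟩, ⟨Pi.single j 1, ?_⟩⟩
    · simp only [smul_smul, inv_mul_cancel₀ ht0.ne', one_smul]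
    · ext k
      by_cases hk : k = j
      · subst hk
        simp
      · simp [hk]
  rw [htop, finrank_top, Module.finrank_fin_fun]
  exact hi

/-- If $K$ lies in the sup-norm ball of radius $R$ and $r < 1/R$, the only possible lattice point of
$rK$ is $0$. -/
theorem exists_pos_le_minimaSet {K : Set (Fin n → ℝ)} (hK : Bornology.IsBounded K) :
    ∃ c : ℝ, 0 < c ∧ ∀ i, ∀ r ∈ minimaSet K (i + 1), c ≤ r := by
  obtain ⟨R, hR0, hR⟩ := hK.exists_pos_norm_le
  refine ⟨R⁻¹, inv_pos.2 hR0, fun i r ⟨hr0, hr⟩ => ?_⟩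
  by_contra! hlt
  have hsub : (r • K) ∩ intLattice n ⊆ {0} := by
    rintro _ ⟨⟨x, hx, rfl⟩, z, hz⟩
    have hz0 : z = 0 := by
      ext j
      have h1 : ‖(r • x) j‖ < 1 := by
        refine (norm_le_pi_norm (r • x) j).trans_lt ?_
        rw [norm_smul, Real.norm_of_nonneg hr0.le]
        calc r * ‖x‖ ≤ r * R := by gcongr; exact hR x hx
          _ < R⁻¹ * R := by gcongr
          _ = 1 := inv_mul_cancel₀ hR0.ne'
      have h2 := congrFun hz j
      simp only at h2
      rw [← h2, Real.norm_eq_abs] at h1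
      have h3 : |z j| < 1 := by exact_mod_cast h1
      exact Int.abs_lt_one_iff.1 h3
    rw [Set.mem_singleton_iff]
    refine hz.symm.trans ?_
    rw [hz0]
    ext
    simp
  have := affDim_mono hsub
  rw [affDim_eq_finrank_span (Set.mem_singleton _)] at this
  rw [Submodule.span_zero_singleton, finrank_bot] at this
  omega

theorem bddBelow_minimaSet (K : Set (Fin n → ℝ)) (i : ℕ) : BddBelow (minimaSet K i) :=
  ⟨0, fun _ h => h.1.le⟩

theorem successiveMinimum_pos {K : Set (Fin n → ℝ)} (hK : Bornology.IsBounded K)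
    (h0 : 0 ∈ interior K) {i : ℕ} (hi : i < n) : 0 < successiveMinimum K (i + 1) := by
  obtain ⟨c, hc, h⟩ := exists_pos_le_minimaSet hK
  exact hc.trans_le (le_csInf (minimaSet_nonempty h0 hi) (h i))

theorem successiveMinimum_mono {K : Set (Fin n → ℝ)} (h0 : 0 ∈ interior K) {i j : ℕ}
    (hij : i ≤ j) (hj : j ≤ n) : successiveMinimum K i ≤ successiveMinimum K j :=
  csInf_le_csInf (bddBelow_minimaSet K i) (minimaSet_nonempty h0 hj)
    fun _ hr => ⟨hr.1, hij.trans hr.2⟩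

/-- The successive minima of a convex body are attained. -/
theorem isLeast_successiveMinimum {K : Set (Fin n → ℝ)} (hK : IsCompact K) (hconv : Convex ℝ K)
    (h0 : 0 ∈ interior K) {i : ℕ} (hi : i < n) :
    IsLeast (minimaSet K (i + 1)) (successiveMinimum K (i + 1)) := by
  have hne := minimaSet_nonempty h0 (Nat.succ_le_of_lt hi)
  have hbb := bddBelow_minimaSet K (i + 1)
  have hpos := successiveMinimum_pos hK.isBounded h0 hi
  refine ⟨⟨hpos, ?_⟩, fun r hr => csInf_le hbb hr⟩
  set μ := successiveMinimum K (i + 1) with hμ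
  have hfin : (((μ + 1) • K) ∩ intLattice n).Finite :=
    finite_inter_intLattice (hK.isBounded.smul₀ _)
  -- $(\mu+1)K$ contains finitely many lattice points and $K$ is closed, so dilating slightly beyond
  -- $\mu$ catches no new ones.
  have hev : ∀ᶠ r in 𝓝 μ, ∀ z ∈ ((μ + 1) • K) ∩ intLattice n, z ∈ r • K → z ∈ μ • K := by
    refine (hfin.eventually_all).2 fun z _ => ?_
    by_cases hz : z ∈ μ • K
    · exact Eventually.of_forall fun _ _ => hz
    · rw [Set.mem_smul_set_iff_inv_smul_mem₀ hpos.ne'] at hz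
      have hc : Tendsto (fun r : ℝ => r⁻¹ • z) (𝓝 μ) (𝓝 (μ⁻¹ • z)) :=
        (tendsto_inv₀ hpos.ne').smul_const z
      filter_upwards [hc (hK.isClosed.isOpen_compl.mem_nhds hz), lt_mem_nhds hpos]
        with r hr hr0 hzr
      rw [Set.mem_smul_set_iff_inv_smul_mem₀ hr0.ne'] at hzr
      exact absurd hzr hr
  have hfreq := mem_closure_iff_frequently.1 (csInf_mem_closure hne hbb)
  obtain ⟨r, hr, hall, hlt⟩ := (hfreq.and_eventually
    (hev.and (gt_mem_nhds (show μ < μ + 1 by linarith)))).exists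
  refine hr.2.trans (affDim_mono fun z hz => ⟨hall z ⟨?_, hz.2⟩ hz.1, hz.2⟩)
  exact smul_subset_smul_of_le hconv (interior_subset h0) hr.1 hlt.le hz.1

/-- The finitely many lattice points of $\mu\,\mathrm{int}\,K$ already lie in $rK$ for some $r <
\mu$; a span of dimension above $i$ would contradict the infimum. This supplies the subspaces for
`minkowski_second`. -/
theorem finrank_span_smul_interior_le {K : Set (Fin n → ℝ)} (hK : IsCompact K)
    (h0 : 0 ∈ interior K) {i : ℕ} (hi : i < n) :
    Module.finrank ℝ (Submodule.span ℝ
      ((successiveMinimum K (i + 1) • interior K) ∩ intLattice n)) ≤ i := by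
  have hpos := successiveMinimum_pos hK.isBounded h0 hi
  set μ := successiveMinimum K (i + 1) with hμ
  by_contra! hlt
  have hfin : ((μ • interior K) ∩ intLattice n).Finite :=
    finite_inter_intLattice ((hK.isBounded.subset interior_subset).smul₀ _)
  have hev : ∀ᶠ r in 𝓝 μ, ∀ z ∈ (μ • interior K) ∩ intLattice n, z ∈ r • K := by
    refine (hfin.eventually_all).2 fun z hz => ?_
    have hz := hz.1
    rw [Set.mem_smul_set_iff_inv_smul_mem₀ hpos.ne'] at hz
    have hc : Tendsto (fun r : ℝ => r⁻¹ • z) (𝓝 μ) (𝓝 (μ⁻¹ • z)) :=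
      (tendsto_inv₀ hpos.ne').smul_const z
    filter_upwards [hc (isOpen_interior.mem_nhds hz), lt_mem_nhds hpos] with r hr hr0
    rw [Set.mem_smul_set_iff_inv_smul_mem₀ hr0.ne']
    exact interior_subset hr
  obtain ⟨r, ⟨hall, hr0⟩, hrμ⟩ := (((hev.and (lt_mem_nhds hpos)).filter_mono
    nhdsWithin_le_nhds).and (self_mem_nhdsWithin : ∀ᶠ r in 𝓝[<] μ, r ∈ Set.Iio μ)).exists
  have hrμ : r < μ := hrμ
  have hmem : (0 : Fin n → ℝ) ∈ (r • K) ∩ intLattice n :=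
    ⟨⟨0, interior_subset h0, by simp⟩, zero_mem_intLattice⟩
  have hr : r ∈ minimaSet K (i + 1) := by
    refine ⟨hr0, ?_⟩
    rw [affDim_eq_finrank_span hmem]
    exact (Nat.succ_le_of_lt hlt).trans
      (Submodule.finrank_mono (Submodule.span_mono fun z hz => ⟨hall z hz, hz.2⟩))
  exact absurd (csInf_le (bddBelow_minimaSet K (i + 1)) hr) (not_le.2 hrμ)

/-- **Minkowski's second theorem** (upper bound): the product of the successive minima of a
symmetric convex body with its volume is at most `2 ^ n`. -/
theorem prod_successiveMinimum_mul_volume_le {K : Set (Fin n → ℝ)} (hK : IsCompact K)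
    (hconv : Convex ℝ K) (hsymm : ∀ x ∈ K, -x ∈ K) (h0 : 0 ∈ interior K) :
    (∏ i : Fin n, successiveMinimum K (i + 1)) * volume.real K ≤ 2 ^ n := by
  -- The boundary of a convex set is null, so the theorem for open sets may be applied to the
  -- interior.
  have hint : volume (interior K) = volume K := by
    refine le_antisymm (measure_mono interior_subset) ?_
    calc volume K ≤ volume (interior K ∪ frontier K) := by
          rw [← closure_eq_interior_union_frontier, hK.isClosed.closure_eq]
      _ ≤ volume (interior K) + volume (frontier K) := measure_union_le _ _
      _ = volume (interior K) := by rw [hconv.addHaar_frontier volume, add_zero]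
  have hsymm' : ∀ x ∈ interior K, -x ∈ interior K := by
    intro x hx
    rw [mem_interior_iff_mem_nhds] at hx ⊢
    filter_upwards [(continuous_neg.tendsto (-x)) (by simpa using hx)] with y hy
    simpa using hsymm _ hy
  have h := minkowski_second isOpen_interior hconv.interior hsymm'
    (hK.isBounded.subset interior_subset) (l := fun i => successiveMinimum K (i + 1))
    (fun i hi => successiveMinimum_pos hK.isBounded h0 hi)
    (fun i hi => successiveMinimum_mono h0 (by omega) (by omega))
    (fun i => Submodule.span ℝ ((successiveMinimum K (i + 1) • interior K) ∩ intLattice n))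
    (fun i hi => finrank_span_smul_interior_le hK h0 hi)
    (fun i _ z hz hzU => Submodule.subset_span ⟨hzU, hz⟩)
  rw [hint, Finset.prod_range] at h
  have hnn : 0 ≤ ∏ i : Fin n, successiveMinimum K (i + 1) :=
    Finset.prod_nonneg fun i _ => (successiveMinimum_pos hK.isBounded h0 i.2).le
  have := ENNReal.toReal_mono (by simp) h
  simpa [ENNReal.toReal_mul, ENNReal.toReal_ofReal hnn, Measure.real] using this

end SuccessiveMinima

/-! ### Elementary inequalities and the conclusion -/

theorem le_card_of_interior_nonempty {n m : ℕ} (v : Fin m → Fin n → ℤ)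
    (h : (interior (latticeZonotope v)).Nonempty) : n ≤ m := by
  let V := Submodule.span ℝ (Set.range fun j => toRealVec (v j))
  have hsub : latticeZonotope v ⊆ V := by
    rintro _ ⟨a, -, rfl⟩
    exact V.sum_mem fun j _ => V.smul_mem _ (Submodule.subset_span ⟨j, rfl⟩)
  have htop : V = ⊤ := V.eq_top_of_nonempty_interior' (h.mono (interior_mono hsub))
  have := finrank_range_le_card (R := ℝ) fun j => toRealVec (v j)
  rw [Set.finrank, show Submodule.span ℝ (Set.range fun j => toRealVec (v j)) = ⊤ from htop,
    finrank_top] at this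
  simpa using this

/-- $\binom{m+1}{n+1} = \frac{m+1}{n+1}\binom mn$, and $\frac mn \ge \frac{m+1}{n+1}$ for $0 < n \le
m$. -/
theorem div_pow_le_choose {n m : ℕ} (h : n ≤ m) : ((m : ℝ) / n) ^ n ≤ m.choose n := by
  induction n generalizing m with
  | zero => simp
  | succ n ih =>
    obtain ⟨m, rfl⟩ : ∃ k, m = k + 1 := ⟨m - 1, by omega⟩
    have hnm : n ≤ m := by omega
    have hrec : (((m + 1).choose (n + 1) : ℕ) : ℝ) = (m + 1) / (n + 1) * m.choose n := by
      have := Nat.add_one_mul_choose_eq m n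
      have : ((m : ℝ) + 1) * m.choose n = (m + 1).choose (n + 1) * (n + 1) := by
        exact_mod_cast this
      field_simp
      linarith
    rw [hrec, pow_succ', Nat.cast_add_one, Nat.cast_add_one]
    gcongr
    refine le_trans ?_ (ih hnm)
    rcases Nat.eq_zero_or_pos n with rfl | hn
    · simp
    · gcongr ?_ ^ n
      have : (0 : ℝ) < n := by exact_mod_cast hn
      have : (n : ℝ) ≤ m := by exact_mod_cast hnm
      rw [div_le_div_iff₀ (by positivity) (by positivity)]
      linarith

/-- The inequality of arithmetic and geometric means, in the form: numbers with product at least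
`t ^ n` have sum at least `n * t`. -/
theorem mul_le_sum_of_pow_le_prod {n : ℕ} {x : Fin n → ℝ} (hx : ∀ i, 0 ≤ x i) {t : ℝ}
    (ht : 0 ≤ t) (h : t ^ n ≤ ∏ i, x i) : n * t ≤ ∑ i, x i := by
  rcases Nat.eq_zero_or_pos n with rfl | hn
  · simp
  have hn' : (0 : ℝ) < n := by exact_mod_cast hn
  have := Real.geom_mean_le_arith_mean_weighted Finset.univ (fun _ => (n : ℝ)⁻¹) x
    (fun _ _ => by positivity) (by simp [hn'.ne']) fun i _ => hx i
  rw [Real.finsetProd_rpow _ _ fun i _ => hx i, ← Finset.mul_sum] at this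
  have h2 : t ≤ (∏ i, x i) ^ (n : ℝ)⁻¹ := by
    rw [← Real.pow_rpow_inv_natCast ht hn.ne']
    gcongr
  have h3 := h2.trans this
  rw [inv_mul_eq_div, le_div_iff₀ hn'] at h3
  linarith

theorem sigmaMinima_one {n : ℕ} (P : Set (Fin n → ℝ)) :
    sigmaMinima 1 P = ∑ i : Fin n, 1 / successiveMinimum (P - P) (i.val + 1) := by
  simp [sigmaMinima, MvPolynomial.esymm_one]

theorem mainTheorem6 (n m : ℕ) (v : Fin m → Fin n → ℤ)
    (hprim : ∀ j, IsPrimitiveVec (v j)) (hgen : InGeneralPosition v)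
    (hdim : (interior (latticeZonotope v)).Nonempty) :
    (∃ p : Polynomial ℝ, IsEhrhartPolynomial (latticeZonotope v) p) ∧
    (∀ i : Fin n, IsLeast (minimaSet (latticeZonotope v - latticeZonotope v) (i.val + 1))
      (successiveMinimum (latticeZonotope v - latticeZonotope v) (i.val + 1))) ∧
    ehrhartCoeff 1 (latticeZonotope v) = (m : ℝ) ∧
    (m : ℝ) ≤ ∑ i : Fin n,
      1 / successiveMinimum (latticeZonotope v - latticeZonotope v) (i.val + 1) ∧
    ∑ i : Fin n, 1 / successiveMinimum (latticeZonotope v - latticeZonotope v) (i.val + 1) =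
      sigmaMinima 1 (latticeZonotope v) := by
  obtain ⟨p, hp, hp1, hpn⟩ := exists_ehrhartPolynomial_latticeZonotope hprim hgen
  have hcomp := isCompact_latticeZonotope v
  have hconv := convex_latticeZonotope v
  have hnm := le_card_of_interior_nonempty v hdim
  have hvol : (m.choose n : ℝ) ≤ MeasureTheory.volume.real (latticeZonotope v) := by
    rw [volume_eq_coeff_of_isEhrhartPolynomial hcomp hconv hp]
    exact hpn
  have hDcomp : IsCompact (latticeZonotope v - latticeZonotope v) := by
    rw [sub_eq_add_neg]
    exact hcomp.add hcomp.neg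
  have hDconv : Convex ℝ (latticeZonotope v - latticeZonotope v) := hconv.sub hconv
  have hDsymm : ∀ x ∈ latticeZonotope v - latticeZonotope v,
      -x ∈ latticeZonotope v - latticeZonotope v := by
    rintro _ ⟨x, hx, y, hy, rfl⟩
    exact ⟨y, hy, x, hx, (neg_sub x y).symm⟩
  have hD0 : (0 : Fin n → ℝ) ∈ interior (latticeZonotope v - latticeZonotope v) := by
    obtain ⟨z, hz⟩ := hdim
    exact subset_interior_sub_left ⟨z, hz, z, interior_subset hz, sub_self z⟩
  have hpos : ∀ i : Fin n,
      0 < successiveMinimum (latticeZonotope v - latticeZonotope v) (i.val + 1) :=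
    fun i => successiveMinimum_pos hDcomp.isBounded hD0 i.2
  refine ⟨⟨p, hp⟩, fun i => isLeast_successiveMinimum hDcomp hDconv hD0 i.2,
    (hp.ehrhartCoeff_eq 1).trans hp1, ?_, (sigmaMinima_one _).symm⟩
  have hmink := prod_successiveMinimum_mul_volume_le hDcomp hDconv hDsymm hD0
  have hDvol : MeasureTheory.volume.real (latticeZonotope v - latticeZonotope v) =
      2 ^ n * MeasureTheory.volume.real (latticeZonotope v) := by
    simp [MeasureTheory.Measure.real, volume_latticeZonotope_sub_self]
  set l : Fin n → ℝ := fun i =>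
    successiveMinimum (latticeZonotope v - latticeZonotope v) (i.val + 1)
  have hprod : 0 < ∏ i, l i := Finset.prod_pos fun i _ => hpos i
  -- The $2^n$ in Minkowski's bound cancels against that in the volume of the difference body.
  have hle : (∏ i, l i) * m.choose n ≤ 1 := by
    rw [hDvol, mul_left_comm] at hmink
    have h1 := le_of_mul_le_mul_left (hmink.trans_eq (mul_one _).symm) (by positivity)
    exact (mul_le_mul_of_nonneg_left hvol hprod.le).trans h1
  have key : ((m : ℝ) / n) ^ n ≤ ∏ i, 1 / l i := by
    refine (div_pow_le_choose hnm).trans ?_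
    simp only [one_div, Finset.prod_inv_distrib]
    rw [le_inv_comm₀ (by exact_mod_cast Nat.choose_pos hnm) hprod, ← one_div,
      le_div_iff₀ (by exact_mod_cast Nat.choose_pos hnm)]
    exact hle
  have := mul_le_sum_of_pow_le_prod (fun i => one_div_nonneg.2 (hpos i).le) (by positivity) key
  -- For $n = 0$ the quotient $m/n$ is the default $0$ and AM-GM says nothing; but $\mathbb{Z}^0$
  -- has no primitive vector, the empty gcd being $0$, so $m = 0$.
  rcases Nat.eq_zero_or_pos n with rfl | hn
  · have hm : m = 0 := by
      by_contra hm
      have := hprim ⟨0, Nat.pos_of_ne_zero hm⟩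
      simp [IsPrimitiveVec] at this
    simp [hm]
  · rwa [mul_div_cancel₀ _ (by exact_mod_cast hn.ne')] at this
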